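/- Let $\mathbb K$ be a commutative unital topological ring whose unit group $\mathbb K^\times$ is open and dense in $\mathbb K$ and whose inversion map $\mathbb K^\times\to\mathbb K$ is continuous. Let $V,W$ be topological $\mathbb K$-modules with $W$ Hausdorff, let $U\subset V$ be open, and let $k\ge 0$ be an integer. *Smoothness.* A map $f:U\to W$ is of class $\mathcal C^{[0]}$ if it is continuous, and of class $\mathcal C^{[n+1]}$ if it is continuous and there is a map $f^{[1]}:U^{[1]}\to W$ of class $\mathcal C^{[n]}$ on $U^{[1]}=\{(x,v,t)\in V\times V\times\mathbb K : x\in U,\ x+tv\in U\}$ with $f^{[1]}(x,v,t)=t^{-1}(f(x+tv)-f(x))$ whenever $t\in\mathbb K^\times$. It is smooth over $\mathbb K$ if it is of class $\mathcal C^{[n]}$ for all $n$. The same definition is used over other topological base rings. *Jets.* Put $s_0=0$. For $l\ge 0$ let $U^{\langle l\rangle}$ be the set of $(v_0,\dots,v_l;s_1,\dots,s_l)\in V^{l+1}\times\mathbb K^l$ such that $p_i:=v_0+\sum_{j=1}^i\prod_{m=0}^{j-1}(s_i-s_m)\,v_j\in U$ for $i=0,\dots,l$. Let $f^{\langle l\rangle}:U^{\langle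 l\rangle}\to W$ be the continuous extension, if it exists (it is then unique), of the divided difference $\sum_{i=0}^l f(p_i)\big/\prod_{j\ne i}(s_i-s_j)$, defined on the elements of $U^{\langle l\rangle}$ such that $s_i-s_m\in\mathbb K^\times$ for all $i\neq m$. If $f^{\langle l\rangle}$ exists for all $l\le k$, then $f$ is said to be of class $\mathcal C^{\langle k\rangle}$, and its simplicial $k$-jet is $$\mathrm J^kf:\mathrm J^kU\to \mathrm J^kW,\qquad (v_0,\dots,v_k)\mapsto\bigl(f^{\langle l\rangle}(v_0,\dots,v_l;0,\dots,0)\bigr)_{l=0,\dots,k},$$ where $\mathrm J^kU=U\times V^k\subset \mathrm J^kV=V^{k+1}$ and $\mathrm J^kW=W^{k+1}$. The ring $\mathrm J^k\mathbb K=\mathbb K[X]/(X^{k+1})=\mathbb K\oplus\delta\mathbb K\oplus\dots\oplus\delta^k\mathbb K$ carries the product topology of $\mathbb K^{k+1}$. The spaces $\mathrm J^kV$ and $\mathrm J^kW$, with the product topology, are $\mathrm J^k\mathbb K$-modules: $(v_0,\dots,v_k)$ stands for $v_0+\delta v_1+\dots+\delta^kv_k$, where $\delta^{k+1}=0$. Let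 $\sigma_U:U\to \mathrm J^kU$ and $\sigma_W:W\to \mathrm J^kW$ be the injections $x\mapsto(x,0,\dots,0)$. **Theorem (Simplicial Scalar Extension Theorem).** If $f:U\to W$ is smooth over $\mathbb K$, then $f$ is of class $\mathcal C^{\langle k\rangle}$, and there is exactly one map $F:\mathrm J^kU\to \mathrm J^kW$ such that 1. $F$ is smooth over the ring $\mathrm J^k\mathbb K$, and 2. $F\circ\sigma_U=\sigma_W\circ f$, namely $F=\mathrm J^kf$. More generally, any $\mathrm J^k\mathbb K$-smooth map $F:\mathrm J^kU\to \mathrm J^kW$ is uniquely determined by its restriction to the base $\sigma_U(U)$: if $F,G:\mathrm J^kU\to \mathrm J^kW$ are $\mathrm J^k\mathbb K$-smooth and $F\circ\sigma_U=G\circ\sigma_U$, then $F=G$. -/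

import Mathlib

universe u v w

/-! ## Jet rings and jet modules -/

namespace JetCalc

open Finset

/-- The `k`-th jet ring `J^k K ≅ K[X]/(X^{k+1})`.  The element
`a_0 + a_1 δ + ⋯ + a_k δ^k` (with `δ^{k+1} = 0`) is stored as `(a_0, …, a_k)`. -/
def JetRing (K : Type u) (k : ℕ) : Type u := Fin (k + 1) → K

/-- The space `J^k V = V^{k+1}`.  The element `v_0 + δ v_1 + ⋯ + δ^k v_k` is stored as
`(v_0, …, v_k)`. -/
def JetModule (k : ℕ) (V : Type v) : Type v := Fin (k + 1) → V

section Algebra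

variable {K : Type u} [CommRing K] {V : Type v} [AddCommGroup V] [Module K V] {k : ℕ}

instance : AddCommGroup (JetRing K k) := inferInstanceAs (AddCommGroup (Fin (k + 1) → K))

instance : AddCommGroup (JetModule k V) := inferInstanceAs (AddCommGroup (Fin (k + 1) → V))

/-- The pairs of indices `(i, j)` with `i + j = l`. -/
def pairs (l : Fin (k + 1)) : Finset (Fin (k + 1) × Fin (k + 1)) :=
  univ.filter fun p => (p.1 : ℕ) + (p.2 : ℕ) = (l : ℕ)

/-- Truncated multiplication `(∑ a_i δ^i) (∑ b_j δ^j) = ∑_l (∑_{i+j=l} a_i b_j) δ^l`. -/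
instance : Mul (JetRing K k) := ⟨fun a b l => ∑ p ∈ pairs l, a p.1 * b p.2⟩

instance : One (JetRing K k) := ⟨Pi.single 0 1⟩

/-- Truncated action `(∑ a_i δ^i) • (∑ δ^j v_j) = ∑_l δ^l (∑_{i+j=l} a_i v_j)`. -/
instance : SMul (JetRing K k) (JetModule k V) := ⟨fun a x l => ∑ p ∈ pairs l, a p.1 • x p.2⟩

theorem sum_pairs {M : Type*} [AddCommMonoid M] (l : Fin (k + 1)) (h : ℕ → ℕ → M) :
    ∑ p ∈ pairs l, h p.1 p.2 = ∑ p ∈ antidiagonal (l : ℕ), h p.1 p.2 := by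
  refine Finset.sum_bij (fun p _ => ((p.1 : ℕ), (p.2 : ℕ))) ?_ ?_ ?_ ?_
  · intro p hp
    simpa [pairs] using hp
  · rintro ⟨a, b⟩ _ ⟨c, d⟩ _ h
    simpa [Fin.ext_iff] using h
  · rintro ⟨a, b⟩ hab
    have := l.2
    rw [Finset.HasAntidiagonal.mem_antidiagonal] at hab
    simp only at hab
    exact ⟨(⟨a, by omega⟩, ⟨b, by omega⟩), by simpa [pairs] using hab, rfl⟩
  · intros
    rfl

/-- The first `k + 1` coefficients of a polynomial. -/
def ofPoly (k : ℕ) (p : Polynomial K) : JetRing K k := fun i => p.coeff i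

theorem ofPoly_surj (a : JetRing K k) : ∃ p, ofPoly k p = a := by
  refine ⟨∑ i : Fin (k + 1), Polynomial.monomial (i : ℕ) (a i), ?_⟩
  funext j
  simp only [ofPoly, Polynomial.finsetSum_coeff, Polynomial.coeff_monomial, Fin.val_inj]
  exact Fintype.sum_ite_eq' j _

theorem ofPoly_mul (p q : Polynomial K) : ofPoly k (p * q) = ofPoly k p * ofPoly k q := by
  funext l
  change (p * q).coeff l = ∑ r ∈ pairs l, p.coeff r.1 * q.coeff r.2
  rw [sum_pairs l (fun i j => p.coeff i * q.coeff j), Polynomial.coeff_mul]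

theorem ofPoly_add (p q : Polynomial K) : ofPoly k (p + q) = ofPoly k p + ofPoly k q := by
  funext l
  exact Polynomial.coeff_add p q l

theorem ofPoly_one : ofPoly k (1 : Polynomial K) = 1 := by
  funext l
  change (1 : Polynomial K).coeff l = (Pi.single 0 1 : Fin (k + 1) → K) l
  rw [Polynomial.coeff_one, Pi.single_apply]
  exact if_congr (by rw [Fin.ext_iff]; rfl) rfl rfl

theorem ofPoly_zero : ofPoly k (0 : Polynomial K) = 0 := by
  funext l
  exact Polynomial.coeff_zero _

instance : CommRing (JetRing K k) :=
  { (inferInstance : AddCommGroup (JetRing K k)),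
    (inferInstance : Mul (JetRing K k)), (inferInstance : One (JetRing K k)) with
    mul_assoc := by
      intro a b c
      obtain ⟨p, rfl⟩ := ofPoly_surj a
      obtain ⟨q, rfl⟩ := ofPoly_surj b
      obtain ⟨r, rfl⟩ := ofPoly_surj c
      simp only [← ofPoly_mul, mul_assoc]
    mul_comm := by
      intro a b
      obtain ⟨p, rfl⟩ := ofPoly_surj a
      obtain ⟨q, rfl⟩ := ofPoly_surj b
      simp only [← ofPoly_mul, mul_comm]
    one_mul := by
      intro a
      obtain ⟨p, rfl⟩ := ofPoly_surj a
      rw [← ofPoly_one, ← ofPoly_mul, one_mul]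
    mul_one := by
      intro a
      obtain ⟨p, rfl⟩ := ofPoly_surj a
      rw [← ofPoly_one, ← ofPoly_mul, mul_one]
    left_distrib := by
      intro a b c
      obtain ⟨p, rfl⟩ := ofPoly_surj a
      obtain ⟨q, rfl⟩ := ofPoly_surj b
      obtain ⟨r, rfl⟩ := ofPoly_surj c
      simp only [← ofPoly_mul, ← ofPoly_add, mul_add]
    right_distrib := by
      intro a b c
      obtain ⟨p, rfl⟩ := ofPoly_surj a
      obtain ⟨q, rfl⟩ := ofPoly_surj b
      obtain ⟨r, rfl⟩ := ofPoly_surj c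
      simp only [← ofPoly_mul, ← ofPoly_add, add_mul]
    zero_mul := by
      intro a
      obtain ⟨p, rfl⟩ := ofPoly_surj a
      rw [← ofPoly_zero, ← ofPoly_mul, zero_mul]
    mul_zero := by
      intro a
      obtain ⟨p, rfl⟩ := ofPoly_surj a
      rw [← ofPoly_zero, ← ofPoly_mul, mul_zero] }

/-- The first `k + 1` coefficients of a polynomial with coefficients in `V`. -/
def ofPolyModule (k : ℕ) (g : PolynomialModule K V) : JetModule k V := fun i => g.coeff i

theorem ofPolyModule_surj (x : JetModule k V) :
    ∃ g : PolynomialModule K V, ofPolyModule k g = x := by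
  refine ⟨∑ i : Fin (k + 1), PolynomialModule.single K (i : ℕ) (x i), ?_⟩
  funext j
  simp only [ofPolyModule, PolynomialModule.coeff_sum, PolynomialModule.coeff_single,
    Finsupp.finsetSum_apply, Finsupp.single_apply, Fin.val_inj]
  exact Fintype.sum_ite_eq' j _

theorem ofPolyModule_smul (p : Polynomial K) (g : PolynomialModule K V) :
    ofPolyModule k (p • g) = ofPoly k p • ofPolyModule k g := by
  funext l
  change (p • g).coeff (l : ℕ) = ∑ r ∈ pairs l, p.coeff r.1 • g.coeff (r.2 : ℕ)
  rw [sum_pairs l (fun i j => p.coeff i • g.coeff j), PolynomialModule.smul_apply]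

instance : Module (JetRing K k) (JetModule k V) where
  one_smul := by
    intro x
    obtain ⟨g, rfl⟩ := ofPolyModule_surj (K := K) x
    rw [← ofPoly_one, ← ofPolyModule_smul, one_smul]
  mul_smul := by
    intro a b x
    obtain ⟨p, rfl⟩ := ofPoly_surj a
    obtain ⟨q, rfl⟩ := ofPoly_surj b
    obtain ⟨g, rfl⟩ := ofPolyModule_surj (K := K) x
    simp only [← ofPoly_mul, ← ofPolyModule_smul, mul_smul]
  smul_zero := by
    intro a
    funext l
    exact Finset.sum_eq_zero fun p _ => smul_zero (a p.1)
  smul_add := by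
    intro a x y
    funext l
    exact (Finset.sum_congr rfl fun p _ => smul_add (a p.1) (x p.2) (y p.2)).trans
      Finset.sum_add_distrib
  zero_smul := by
    intro x
    funext l
    exact Finset.sum_eq_zero fun p _ => zero_smul K (x p.2)
  add_smul := by
    intro a b x
    funext l
    exact (Finset.sum_congr rfl fun p _ => add_smul (a p.1) (b p.1) (x p.2)).trans
      Finset.sum_add_distrib

end Algebra

instance {K : Type u} [TopologicalSpace K] {k : ℕ} : TopologicalSpace (JetRing K k) :=
  inferInstanceAs (TopologicalSpace (Fin (k + 1) → K))

instance {V : Type v} [TopologicalSpace V] {k : ℕ} : TopologicalSpace (JetModule k V) :=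
  inferInstanceAs (TopologicalSpace (Fin (k + 1) → V))

/-- The canonical injection `σ : V → J^k V`, `x ↦ (x, 0, …, 0)`. -/
def jetBase {V : Type v} [AddCommGroup V] (k : ℕ) (x : V) : JetModule k V :=
  fun i => if i = 0 then x else 0

/-- The jet domain `J^k U = U × V^k`. -/
def jetDomain {V : Type v} (k : ℕ) (U : Set V) : Set (JetModule k V) :=
  {x | x 0 ∈ U}

/-! ## Cubic differential calculus

A map `U → W` is represented by a function `V → W` whose values outside `U` are irrelevant. -/

/-- The extended domain `U^{[1]}`. -/
def extDomain (K : Type u) [CommRing K] {V : Type v} [AddCommGroup V] [Module K V]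
    (U : Set V) : Set (V × V × K) :=
  {p | p.1 ∈ U ∧ p.1 + p.2.2 • p.2.1 ∈ U}

/-- `f : U → W` is of class `C^{[n]}` over `K`: it is continuous and, for `n = m + 1`, its
difference quotient `(f (x + t v) - f x) / t`, defined for `(x, v, t) ∈ U^{[1]}` with
invertible `t`, extends to a map `f^{[1]} : U^{[1]} → W` of class `C^{[m]}`
(in particular continuous). -/
def IsCubicC (K : Type u) [CommRing K] [TopologicalSpace K]
    {W : Type w} [AddCommGroup W] [Module K W] [TopologicalSpace W] :
    (n : ℕ) → {V : Type (max u v)} → [AddCommGroup V] → [Module K V] → [TopologicalSpace V] →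
      (U : Set V) → (f : V → W) → Prop
  | 0, _, _, _, _, U, f => ContinuousOn f U
  | n + 1, V, _, _, _, U, f =>
      ContinuousOn f U ∧ ∃ g : V × V × K → W,
        (∀ (x y : V) (t : Kˣ), (x, y, (t : K)) ∈ extDomain K U →
          g (x, y, (t : K)) = ((t⁻¹ : Kˣ) : K) • (f (x + (t : K) • y) - f x)) ∧
        IsCubicC K n (extDomain K U) g

/-- `f : U → W` is smooth over `K`: it is of class `C^{[n]}` for every `n`. -/
def IsSmooth (K : Type u) [CommRing K] [TopologicalSpace K]
    {V : Type (max u v)} [AddCommGroup V] [Module K V] [TopologicalSpace V]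
    {W : Type w} [AddCommGroup W] [Module K W] [TopologicalSpace W]
    (U : Set V) (f : V → W) : Prop :=
  ∀ n : ℕ, IsCubicC.{u, v, w} K n U f

/-! ## Simplicial differential calculus -/

section Simplicial

variable {K : Type u} [CommRing K] {V : Type v} [AddCommGroup V] [Module K V]
  {W : Type w} [AddCommGroup W] [Module K W] {l : ℕ}

/-- The scalars `(s_0, s_1, …, s_l)` with `s_0 = 0`. -/
def nodes (s : Fin l → K) : Fin (l + 1) → K := Fin.cons 0 s

/-- The point `v_0 + ∑_{j=1}^i ∏_{m=0}^{j-1} (s_i - s_m) v_j`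
(the summand for `j = 0` is `v_0`, with an empty product). -/
def simplexPoint (x : Fin (l + 1) → V) (s : Fin l → K) (i : Fin (l + 1)) : V :=
  ∑ j ∈ Iic i, (∏ m ∈ Iio j, (nodes s i - nodes s m)) • x j

variable (K l) in
/-- The extended simplicial domain `U^{⟨l⟩}` (which is `U` for `l = 0`). -/
def simplicialDomain (U : Set V) : Set ((Fin (l + 1) → V) × (Fin l → K)) :=
  {p | ∀ i, simplexPoint p.1 p.2 i ∈ U}

variable (K l) in
/-- The set `U^{⟩l⟨}` of non-singular elements of `U^{⟨l⟩}`. -/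
def nonsingularDomain (U : Set V) : Set ((Fin (l + 1) → V) × (Fin l → K)) :=
  {p | p ∈ simplicialDomain K l U ∧ ∀ i m, i ≠ m → IsUnit (nodes p.2 i - nodes p.2 m)}

/-- The generalized divided difference `f^{⟩l⟨}`, meant for non-singular arguments
(it is `f` for `l = 0`). -/
noncomputable def dividedDiff (f : V → W) (p : (Fin (l + 1) → V) × (Fin l → K)) : W :=
  ∑ i, Ring.inverse (∏ j ∈ univ.erase i, (nodes p.2 i - nodes p.2 j)) •
    f (simplexPoint p.1 p.2 i)

variable [TopologicalSpace K] [TopologicalSpace V] [TopologicalSpace W]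

variable (K) in
/-- `f : U → W` is of class `C^{⟨k⟩}` over `K`: for all `l ≤ k`, the map `f^{⟩l⟨}` extends to a
continuous map `U^{⟨l⟩} → W`.  For `l = 0` this says that `f` is continuous. -/
def IsSimplicialC (k : ℕ) (U : Set V) (f : V → W) : Prop :=
  ∀ l ≤ k, ∃ g : (Fin (l + 1) → V) × (Fin l → K) → W,
    ContinuousOn g (simplicialDomain K l U) ∧ Set.EqOn g (dividedDiff f) (nonsingularDomain K l U)

variable (K l) in
/-- The extension by continuity `f^{⟨l⟩}` of `f^{⟩l⟨}` to `U^{⟨l⟩}`. -/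
noncomputable def simplicialDiff (U : Set V) (f : V → W) :
    (Fin (l + 1) → V) × (Fin l → K) → W :=
  extendFrom (nonsingularDomain K l U) (dividedDiff f)

variable (K) in
/-- The simplicial `k`-jet `J^k f : J^k U → J^k W`,
`(v_0, …, v_k) ↦ (f^{⟨l⟩} (v_0, …, v_l; 0, …, 0))_{l = 0, …, k}`. -/
noncomputable def jetMap (k : ℕ) (U : Set V) (f : V → W) (x : JetModule k V) : JetModule k W :=
  fun l => simplicialDiff K (l : ℕ) U f
    (fun j => x (Fin.castLE (Nat.succ_le_succ (Nat.le_of_lt_succ l.2)) j), 0)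

end Simplicial

end JetCalc

set_option linter.unusedSectionVars false

namespace JetCalc

open Finset Filter Topology

/-! ### Cubic calculus: affine substitution and difference quotients -/

section Cubic

variable {K : Type u} [CommRing K] [TopologicalSpace K]
  {V : Type (max u v)} [AddCommGroup V] [Module K V] [TopologicalSpace V]
  {W : Type w} [AddCommGroup W] [Module K W] [TopologicalSpace W]

/-! A divided difference of order `l + 1` is a difference quotient of one of order `l`: replacing
the node `s l` by `s (l + 1)` and the coefficient `x l` by `x l + (s (l + 1) - s l) • x (l + 1)`
moves the `l`-th Newton point to the next one. Iterating the cubic quotient therefore gives smooth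
extensions `G l` of all divided differences (`IsSmooth.exists_extension`), where sequences replace
tuples so that every `G l` has the same domain type. Hence `f` is simplicially of class `k`, and
density of the nonsingular arguments identifies the jet with the `G l` at zero nodes.

The recursion for the `G l`, with nodes `0, …, 0, t`, telescopes to a Taylor formula with continuous
remainder (`IsExtension.taylor`). Taylor coefficients along a curve are unique because invertible
scalars accumulate at `0`. So the jet of `f` at `x` is the Taylor expansion of `f` along a curve
with jet `x`.

Smoothness of the jet map: comparing Taylor coefficients in `t • g (x, y, t) = f (x + t • y) - f x`
along polynomial curves shows that the jet of the quotient `g` is a quotient of the jet of `f` over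
the jet ring (`smul_jetMap_quotient`); then induct on the order.

Uniqueness: the Taylor formula also holds over the jet ring. At the scalar `δ` the remainder carries
the factor `δ ^ (k + 1) = 0`, so `F z` is a sum of `δ ^ j` times Taylor coefficients. Restricting
the scalar to `K` shows that these coefficients depend only on the values of `F` on the base
(`IsSmooth.exists_hasTaylor_jetBase`). -/

theorem IsCubicC.continuousOn {n : ℕ} {U : Set V} {f : V → W}
    (h : IsCubicC.{u, v, w} K n U f) : ContinuousOn f U := by
  cases n with
  | zero => exact h
  | succ n => exact h.1

theorem IsSmooth.continuousOn {U : Set V} {f : V → W}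
    (h : IsSmooth.{u, v, w} K U f) : ContinuousOn f U := (h 0).continuousOn

theorem IsCubicC.congr {n : ℕ} {U : Set V} {f f' : V → W}
    (h : IsCubicC.{u, v, w} K n U f) (e : Set.EqOn f' f U) : IsCubicC.{u, v, w} K n U f' := by
  cases n with
  | zero => exact ContinuousOn.congr h e
  | succ n =>
    obtain ⟨hc, g, hg, hgn⟩ := h
    refine ⟨hc.congr e, g, fun x y t hp => ?_, hgn⟩
    rw [hg x y t hp, e hp.1, e hp.2]

/-- A quotient of the composite is the old quotient composed with `L × L × id` shifted by `(c, 0,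
0)`, which is again affine, so the induction runs over all modules at once. The constant `c`
matters: the substitution that raises the order of divided differences is not linear. -/
theorem IsCubicC.comp_affine {n : ℕ} : ∀ {V' V : Type (max u v)}
    [AddCommGroup V'] [Module K V'] [TopologicalSpace V']
    [AddCommGroup V] [Module K V] [TopologicalSpace V] [ContinuousAdd V] [ContinuousAdd K]
    {U : Set V} {f : V → W}, IsCubicC.{u, v, w} K n U f →
    ∀ (L : V' →L[K] V) (c : V),
      IsCubicC.{u, v, w} K n ((fun x => L x + c) ⁻¹' U) (fun x => f (L x + c)) := by
  induction n with
  | zero =>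
    intro V' V _ _ _ _ _ _ _ _ U f h L c
    exact ContinuousOn.comp (t := U) h (L.continuous.add continuous_const).continuousOn
      (fun x hx => hx)
  | succ n ih =>
    intro V' V _ _ _ _ _ _ _ _ U f h L c
    obtain ⟨hc, g, hg, hgn⟩ := h
    have key (x y : V') (t : K) : L (x + t • y) + c = L x + c + t • L y := by
      rw [map_add, map_smul]; abel
    refine ⟨ContinuousOn.comp (t := U) hc (L.continuous.add continuous_const).continuousOn
      (fun x hx => hx), fun p => g (L p.1 + c, L p.2.1, p.2.2), fun x y t hp => ?_, ?_⟩
    · have hp2 := hp.2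
      simp only [Set.mem_preimage, key] at hp2
      refine (hg (L x + c) (L y) t ⟨hp.1, hp2⟩).trans ?_
      simp only [key]
    · let A := L.prodMap (L.prodMap (ContinuousLinearMap.id K K))
      have hA (p : V' × V' × K) : A p + (c, 0, 0) = (L p.1 + c, L p.2.1, p.2.2) := by
        simp [A, Prod.ext_iff]
      have hs : extDomain K ((fun x => L x + c) ⁻¹' U) =
          (fun p => A p + (c, 0, 0)) ⁻¹' extDomain K U := by
        ext p
        simp only [extDomain, Set.mem_preimage, Set.mem_ofPred_eq, hA, key]
      rw [hs]
      exact (ih hgn A (c, 0, 0)).congr fun p _ => by simp only [hA]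

theorem IsSmooth.congr {U : Set V} {f f' : V → W}
    (h : IsSmooth.{u, v, w} K U f) (e : Set.EqOn f' f U) : IsSmooth.{u, v, w} K U f' :=
  fun n => (h n).congr e

theorem IsSmooth.comp_affine {V' : Type (max u v)}
    [AddCommGroup V'] [Module K V'] [TopologicalSpace V'] [ContinuousAdd V] [ContinuousAdd K]
    {U : Set V} {f : V → W} (h : IsSmooth.{u, v, w} K U f) (L : V' →L[K] V) (c : V) :
    IsSmooth.{u, v, w} K ((fun x => L x + c) ⁻¹' U) (fun x => f (L x + c)) :=
  fun n => (h n).comp_affine L c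

theorem isOpen_extDomain [IsTopologicalRing K] [IsTopologicalAddGroup V] [ContinuousSMul K V]
    {U : Set V} (hU : IsOpen U) : IsOpen (extDomain K U) :=
  (hU.preimage continuous_fst).inter (hU.preimage (f := fun p : V × V × K => p.1 + p.2.2 • p.2.1)
    (by fun_prop))

theorem eqOn_extDomain_of_isUnit [IsTopologicalRing K] [IsTopologicalAddGroup V]
    [ContinuousSMul K V] {W : Type w} [TopologicalSpace W] [T2Space W]
    (hd : Dense {t : K | IsUnit t}) {U : Set V} (hU : IsOpen U)
    {φ ψ : V × V × K → W} (hφ : ContinuousOn φ (extDomain K U))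
    (hψ : ContinuousOn ψ (extDomain K U))
    (h : ∀ x y (t : Kˣ), (x, y, (t : K)) ∈ extDomain K U → φ (x, y, (t : K)) = ψ (x, y, (t : K))) :
    Set.EqOn φ ψ (extDomain K U) := by
  have hD : Dense ((Set.univ : Set V) ×ˢ ((Set.univ : Set V) ×ˢ {t : K | IsUnit t})) :=
    dense_univ.prod (dense_univ.prod hd)
  refine Set.EqOn.of_subset_closure (s := extDomain K U ∩ _) ?_ hφ hψ Set.inter_subset_left
    (hD.open_subset_closure_inter (isOpen_extDomain hU))
  rintro ⟨x, y, t⟩ ⟨hp, -, -, ⟨t, rfl⟩⟩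
  exact h x y t hp

/-- A smooth map has a smooth difference quotient map. -/
theorem IsSmooth.exists_quotient [IsTopologicalRing K] [IsTopologicalAddGroup V]
    [ContinuousSMul K V] [IsTopologicalAddGroup W] [ContinuousSMul K W] [T2Space W]
    (hd : Dense {t : K | IsUnit t}) {U : Set V} (hU : IsOpen U)
    {f : V → W} (hf : IsSmooth.{u, v, w} K U f) :
    ∃ g : V × V × K → W, IsSmooth.{u, v, w} K (extDomain K U) g ∧
      ∀ x y t, (x, y, t) ∈ extDomain K U → t • g (x, y, t) = f (x + t • y) - f x := by
  obtain ⟨hc, g, hg, hgc⟩ := hf 1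
  refine ⟨g, fun n => ?_, fun x y t hp => ?_⟩
  -- Each order `n` comes with its own quotient map; by density of invertible `t` they all agree
  -- with `g` on the extended domain.
  · obtain ⟨-, g', hg', hgn⟩ := hf (n + 1)
    refine hgn.congr (eqOn_extDomain_of_isUnit hd hU hgc.continuousOn hgn.continuousOn ?_)
    intro x y t hp
    rw [hg x y t hp, hg' x y t hp]
  -- Multiplied by `t`, the identity has two continuous sides and so passes from invertible `t` to
  -- every `t`. Singular scalars do occur later, in the recursion and along curves.
  · refine eqOn_extDomain_of_isUnit (φ := fun p => p.2.2 • g p)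
      (ψ := fun p => f (p.1 + p.2.2 • p.2.1) - f p.1) hd hU ?_ ?_ ?_ hp
    · exact (continuous_snd.comp continuous_snd).continuousOn.smul hgc.continuousOn
    · refine ContinuousOn.sub ?_ ?_
      · exact hc.comp (t := U) (Continuous.continuousOn (by fun_prop)) fun p hp => hp.2
      · exact hc.comp (t := U) continuous_fst.continuousOn fun p hp => hp.1
    · intro x y t hp
      simp only [hg x y t hp, smul_smul, Units.mul_inv, one_smul]

end Cubic

/-! ### Newton points and the replacement of a node -/

section Newton

variable {K : Type u} [CommRing K] {V : Type v} [AddCommGroup V] [Module K V]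

/-- The Newton polynomial with coefficients `v` and nodes `s`, evaluated at `s i`. -/
def newtonPoint (x : ℕ → V) (s : ℕ → K) (i : ℕ) : V :=
  ∑ j ∈ range (i + 1), (∏ m ∈ range j, (s i - s m)) • x j

theorem newtonPoint_congr {x x' : ℕ → V} {s s' : ℕ → K} {i : ℕ}
    (hx : ∀ j ≤ i, x j = x' j) (hs : ∀ j ≤ i, s j = s' j) :
    newtonPoint x s i = newtonPoint x' s' i := by
  refine sum_congr rfl fun j hj => ?_
  rw [mem_range] at hj
  rw [hx j (by omega), hs i le_rfl]
  congr 1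
  refine prod_congr rfl fun m hm => ?_
  rw [mem_range] at hm
  rw [hs m (by omega)]

theorem newtonPoint_zero (x : ℕ → V) (s : ℕ → K) : newtonPoint x s 0 = x 0 := by
  simp [newtonPoint]

/-- The coefficients obtained by replacing the node `s l` by `s (l + 1)`. -/
def shiftCoeff (l : ℕ) (x : ℕ → V) (s : ℕ → K) : ℕ → V :=
  Function.update x l (x l + (s (l + 1) - s l) • x (l + 1))

/-- The nodes with `s l` replaced by `s (l + 1)`. -/
def shiftNode (l : ℕ) (s : ℕ → K) : ℕ → K := Function.update s l (s (l + 1))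

theorem newtonPoint_shift_of_lt (x : ℕ → V) (s : ℕ → K) {i l : ℕ} (h : i < l) :
    newtonPoint (shiftCoeff l x s) (shiftNode l s) i = newtonPoint x s i :=
  newtonPoint_congr (fun _ _ => Function.update_of_ne (by omega) _ _)
    (fun _ _ => Function.update_of_ne (by omega) _ _)

/-- The last two terms of the Newton sum at `s (l + 1)` share the factor `∏ m < l, (s (l + 1) - s
m)`; merging them produces the shifted coefficient. -/
theorem newtonPoint_shift_self (x : ℕ → V) (s : ℕ → K) (l : ℕ) :
    newtonPoint (shiftCoeff l x s) (shiftNode l s) l = newtonPoint x s (l + 1) := by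
  have hp : ∀ j ≤ l, ∏ m ∈ range j, (shiftNode l s l - shiftNode l s m) =
      ∏ m ∈ range j, (s (l + 1) - s m) := by
    intro j hj
    refine prod_congr rfl fun m hm => ?_
    rw [mem_range] at hm
    simp only [shiftNode, Function.update_self]
    rw [Function.update_of_ne (by omega)]
  unfold newtonPoint
  rw [sum_range_succ, sum_range_succ _ (l + 1), sum_range_succ _ l, hp l le_rfl, add_assoc]
  congr 1
  · refine sum_congr rfl fun j hj => ?_
    rw [mem_range] at hj
    rw [hp j (by omega), shiftCoeff, Function.update_of_ne (by omega)]
  · rw [shiftCoeff, Function.update_self, smul_add, smul_smul, prod_range_succ]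

/-- The sequences of coefficients and nodes whose first `l + 1` Newton points lie in `U`. -/
def seqDomain (K : Type u) [CommRing K] {V : Type v} [AddCommGroup V] [Module K V]
    (U : Set V) (l : ℕ) : Set ((ℕ → V) × (ℕ → K)) :=
  {p | ∀ i ≤ l, newtonPoint p.1 p.2 i ∈ U}

theorem seqDomain_congr {U : Set V} {l : ℕ} {x x' : ℕ → V} {s s' : ℕ → K}
    (hx : ∀ j ≤ l, x j = x' j) (hs : ∀ j ≤ l, s j = s' j) :
    (x, s) ∈ seqDomain K U l ↔ (x', s') ∈ seqDomain K U l := by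
  refine forall₂_congr fun i hi => ?_
  simp only
  rw [newtonPoint_congr (fun j hj => hx j (hj.trans hi)) (fun j hj => hs j (hj.trans hi))]

/-- This makes the domain of order `l + 1` match the extended domain of order `l`: base point and
moved point must both be admissible. -/
theorem seqDomain_succ {U : Set V} {l : ℕ} {x : ℕ → V} {s : ℕ → K} :
    (x, s) ∈ seqDomain K U (l + 1) ↔
      (x, s) ∈ seqDomain K U l ∧ (shiftCoeff l x s, shiftNode l s) ∈ seqDomain K U l := by
  constructor
  · intro h
    refine ⟨fun i hi => h i (by omega), fun i hi => ?_⟩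
    rcases hi.lt_or_eq with hi | rfl
    · simpa only [newtonPoint_shift_of_lt x s hi] using h i (by omega)
    · simpa only [newtonPoint_shift_self] using h (i + 1) le_rfl
  · rintro ⟨h, h'⟩ i hi
    rcases Nat.le_succ_iff.1 hi with hi | rfl
    · exact h i hi
    · simpa only [newtonPoint_shift_self] using h' l le_rfl

theorem isOpen_seqDomain [TopologicalSpace K] [IsTopologicalRing K] [TopologicalSpace V]
    [IsTopologicalAddGroup V] [ContinuousSMul K V] {U : Set V} (hU : IsOpen U) (l : ℕ) :
    IsOpen (seqDomain K U l) := by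
  have : seqDomain K U l = ⋂ i ∈ Set.Iic l, (fun p => newtonPoint p.1 p.2 i) ⁻¹' U := by
    ext; simp [seqDomain]
  rw [this]
  refine (Set.finite_Iic l).isOpen_biInter fun i _ => hU.preimage ?_
  unfold newtonPoint
  fun_prop

end Newton

/-! ### The recursion for divided differences -/

section DividedDifference

variable {K : Type u} [CommRing K] {W : Type w} [AddCommGroup W] [Module K W]

/-- The divided difference of the values `y` at the nodes `s 0, …, s l`. -/
noncomputable def seqDividedDiff (l : ℕ) (s : ℕ → K) (y : ℕ → W) : W :=
  ∑ i ∈ range (l + 1), Ring.inverse (∏ j ∈ (range (l + 1)).erase i, (s i - s j)) • y i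

theorem seqDividedDiff_congr {l : ℕ} {s : ℕ → K} {y y' : ℕ → W} (h : ∀ i ≤ l, y i = y' i) :
    seqDividedDiff l s y = seqDividedDiff l s y' :=
  sum_congr rfl fun i hi => by rw [h i (by simpa [Nat.lt_succ_iff] using hi)]

theorem seqDividedDiff_succ {l : ℕ} {s : ℕ → K} (y : ℕ → W)
    (hs : ∀ i ≤ l + 1, ∀ j ≤ l + 1, i ≠ j → IsUnit (s i - s j)) :
    (s (l + 1) - s l) • seqDividedDiff (l + 1) s y =
      seqDividedDiff l (shiftNode l s) (Function.update y l (y (l + 1))) -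
        seqDividedDiff l s y := by
  have hinv : ∀ i ≤ l + 1, ∀ j ≤ l + 1, i ≠ j →
      (s i - s j) * Ring.inverse (s i - s j) = 1 :=
    fun i hi j hj hij => Ring.mul_inverse_cancel _ (hs i hi j hj hij)
  have e1 : (range (l + 1)).erase l = range l := by
    rw [range_add_one, erase_insert (by simp)]
  have e2 : (range (l + 1 + 1)).erase (l + 1) = range (l + 1) := by
    rw [range_add_one, erase_insert (by simp)]
  have e3 : (range (l + 1 + 1)).erase l = insert (l + 1) (range l) := by
    rw [range_add_one, erase_insert_of_ne (by omega), e1]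
  have e4 : ∀ i < l, (range (l + 1)).erase i = insert l ((range l).erase i) := fun i hi => by
    rw [range_add_one, erase_insert_of_ne (by omega)]
  have e5 : ∀ i < l, (range (l + 1 + 1)).erase i =
      insert (l + 1) (insert l ((range l).erase i)) := fun i hi => by
    rw [range_add_one, erase_insert_of_ne (by omega), e4 i hi]
  unfold seqDividedDiff
  rw [sum_range_succ, sum_range_succ _ l, sum_range_succ _ l, sum_range_succ _ l, e1, e2, e3,
    smul_add, smul_add, smul_sum]
  have h1 : ∑ i ∈ range l, (s (l + 1) - s l) •
        Ring.inverse (∏ j ∈ (range (l + 1 + 1)).erase i, (s i - s j)) • y i =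
      ∑ i ∈ range l, Ring.inverse (∏ j ∈ (range (l + 1)).erase i,
          (shiftNode l s i - shiftNode l s j)) • Function.update y l (y (l + 1)) i -
        ∑ i ∈ range l, Ring.inverse (∏ j ∈ (range (l + 1)).erase i, (s i - s j)) • y i := by
    rw [← sum_sub_distrib]
    refine sum_congr rfl fun i hi => ?_
    rw [mem_range] at hi
    have hQ : ∏ j ∈ (range l).erase i, (shiftNode l s i - shiftNode l s j) =
        ∏ j ∈ (range l).erase i, (s i - s j) := by
      refine prod_congr rfl fun j hj => ?_
      have := mem_range.1 (mem_of_mem_erase hj)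
      rw [shiftNode, Function.update_of_ne (by omega), Function.update_of_ne (by omega)]
    rw [e5 i hi, e4 i hi, prod_insert (by simp), prod_insert (by simp), prod_insert (by simp), hQ,
      Function.update_of_ne (by omega), smul_smul, ← sub_smul]
    congr 1
    have h3 : shiftNode l s i - shiftNode l s l = s i - s (l + 1) := by
      rw [shiftNode, Function.update_of_ne (by omega), Function.update_self]
    rw [h3]
    simp only [Ring.mul_inverse_rev]
    have ha := hinv i (by omega) l (by omega) (by omega)
    have hb := hinv i (by omega) (l + 1) (by omega) (by omega)
    generalize Ring.inverse (∏ j ∈ (range l).erase i, (s i - s j)) = Q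
    generalize Ring.inverse (s i - s l) = a at *
    generalize Ring.inverse (s i - s (l + 1)) = b at *
    -- Partial fractions: `(s (l + 1) - s l) * a * b = b - a`, where `a` and `b` invert `s i - s l`
    -- and `s i - s (l + 1)`.
    linear_combination Q * b * ha - Q * a * hb
  have h2 : (s (l + 1) - s l) •
        Ring.inverse (∏ j ∈ insert (l + 1) (range l), (s l - s j)) • y l =
      -(Ring.inverse (∏ j ∈ range l, (s l - s j)) • y l) := by
    rw [prod_insert (by simp), smul_smul, ← neg_smul, Ring.mul_inverse_rev]
    congr 1
    linear_combination (-Ring.inverse (∏ j ∈ range l, (s l - s j))) *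
      hinv l (by omega) (l + 1) (by omega) (by omega)
  have h3 : (s (l + 1) - s l) •
        Ring.inverse (∏ j ∈ range (l + 1), (s (l + 1) - s j)) • y (l + 1) =
      Ring.inverse (∏ j ∈ range l, (shiftNode l s l - shiftNode l s j)) •
        Function.update y l (y (l + 1)) l := by
    have hQ : ∏ j ∈ range l, (shiftNode l s l - shiftNode l s j) =
        ∏ j ∈ range l, (s (l + 1) - s j) := by
      refine prod_congr rfl fun j hj => ?_
      have := mem_range.1 hj
      rw [shiftNode, Function.update_self, Function.update_of_ne (by omega)]
    rw [hQ, prod_range_succ, smul_smul, Ring.mul_inverse_rev, Function.update_self]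
    congr 1
    linear_combination (Ring.inverse (∏ j ∈ range l, (s (l + 1) - s j))) *
      hinv (l + 1) (by omega) l (by omega) (by omega)
  rw [h1, h2, h3]
  abel

end DividedDifference

/-! ### Smooth extensions of the divided differences -/

section Extension

variable {K : Type u} [CommRing K] [TopologicalSpace K] [IsTopologicalRing K]
  {V : Type (max u v)} [AddCommGroup V] [Module K V] [TopologicalSpace V]
  [IsTopologicalAddGroup V] [ContinuousSMul K V]
  {W : Type w} [AddCommGroup W] [Module K W] [TopologicalSpace W]
  [IsTopologicalAddGroup W] [ContinuousSMul K W] [T2Space W]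

/-- A system of smooth extensions of the divided differences of `f`. -/
structure IsExtension (U : Set V) (f : V → W) (G : ℕ → (ℕ → V) × (ℕ → K) → W) : Prop where
  smooth : ∀ l, IsSmooth.{u, v, w} K (seqDomain K U l) (G l)
  congr : ∀ l x x' s s', (∀ j ≤ l, x j = x' j) → (∀ j ≤ l, s j = s' j) → G l (x, s) = G l (x', s')
  zero : ∀ x s, G 0 (x, s) = f (x 0)
  succ : ∀ l x s, (x, s) ∈ seqDomain K U (l + 1) → (s (l + 1) - s l) • G (l + 1) (x, s) =
    G l (shiftCoeff l x s, shiftNode l s) - G l (x, s)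

variable (K V) in
/-- The linear part of the affine map `(x, s) ↦ ((x, s), (x (l + 1) e_l, e_l), s (l + 1) - s l)`,
with the entries of `(x, s)` after the `l`-th truncated. -/
def directionMap (l : ℕ) : ((ℕ → V) × (ℕ → K)) →L[K]
    ((ℕ → V) × (ℕ → K)) × ((ℕ → V) × (ℕ → K)) × K where
  toFun p := ((fun j => if j ≤ l then p.1 j else 0, fun j => if j ≤ l then p.2 j else 0),
    (fun j => if j = l then p.1 (l + 1) else 0, 0), p.2 (l + 1) - p.2 l)
  map_add' p q := by
    refine Prod.ext (Prod.ext ?_ ?_) (Prod.ext (Prod.ext ?_ ?_) ?_)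
    · funext j; by_cases h : j ≤ l <;> simp [h]
    · funext j; by_cases h : j ≤ l <;> simp [h]
    · funext j; by_cases h : j = l <;> simp [h]
    · simp
    · simp only [Prod.snd_add, Pi.add_apply]; ring
  map_smul' c p := by
    refine Prod.ext (Prod.ext ?_ ?_) (Prod.ext (Prod.ext ?_ ?_) ?_)
    · funext j; by_cases h : j ≤ l <;> simp [h]
    · funext j; by_cases h : j ≤ l <;> simp [h]
    · funext j; by_cases h : j = l <;> simp [h]
    · simp
    · simp [mul_sub]
  cont := by
    refine .prodMk (.prodMk (continuous_pi fun j => ?_) (continuous_pi fun j => ?_))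
      (.prodMk (.prodMk (continuous_pi fun j => ?_) continuous_const) (by fun_prop)) <;>
    split_ifs <;> fun_prop

theorem IsSmooth.exists_extension (hd : Dense {t : K | IsUnit t}) {U : Set V} (hU : IsOpen U)
    {f : V → W} (hf : IsSmooth.{u, v, w} K U f) :
    ∃ G : ℕ → (ℕ → V) × (ℕ → K) → W, IsExtension U f G := by
  -- Dependence on the first `l + 1` entries only is carried along with smoothness, since the shift
  -- and the truncation are controlled only on those entries.
  let P (l : ℕ) (g : (ℕ → V) × (ℕ → K) → W) : Prop :=
    IsSmooth.{u, v, w} K (seqDomain K U l) g ∧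
      ∀ x x' s s', (∀ j ≤ l, x j = x' j) → (∀ j ≤ l, s j = s' j) → g (x, s) = g (x', s')
  have step (l : ℕ) (g : {g // P l g}) : ∃ g' : {g // P (l + 1) g}, ∀ x s,
      (x, s) ∈ seqDomain K U (l + 1) → (s (l + 1) - s l) • g'.1 (x, s) =
        g.1 (shiftCoeff l x s, shiftNode l s) - g.1 (x, s) := by
    obtain ⟨g, hg, hgl⟩ := g
    obtain ⟨q, hq, hqe⟩ := hg.exists_quotient.{u, v, w} hd (isOpen_seqDomain hU l)
    -- The node `s l` moves with unit speed for time `s (l + 1) - s l`; this unit direction is the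
    -- non-linear part of the substitution.
    let c : ((ℕ → V) × (ℕ → K)) × ((ℕ → V) × (ℕ → K)) × K :=
      (0, (0, fun j => if j = l then 1 else 0), 0)
    have hA (x : ℕ → V) (s : ℕ → K) : directionMap K V l (x, s) + c =
        ((fun j => if j ≤ l then x j else 0, fun j => if j ≤ l then s j else 0),
          (fun j => if j = l then x (l + 1) else 0, fun j => if j = l then 1 else 0),
          s (l + 1) - s l) := by
      refine Prod.ext ?_ (Prod.ext (Prod.ext ?_ ?_) ?_) <;> simp [directionMap, c]
    have hx (x : ℕ → V) (s : ℕ → K) (j : ℕ) (hj : j ≤ l) :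
        ((fun j => if j ≤ l then x j else 0) +
          (s (l + 1) - s l) • fun j => if j = l then x (l + 1) else 0) j = shiftCoeff l x s j := by
      by_cases h : j = l <;> simp [shiftCoeff, h, hj]
    have hs (s : ℕ → K) (j : ℕ) (hj : j ≤ l) :
        ((fun j => if j ≤ l then s j else 0 : ℕ → K) +
          (s (l + 1) - s l) • (fun j => if j = l then 1 else 0 : ℕ → K)) j = shiftNode l s j := by
      by_cases h : j = l <;> simp [shiftNode, h, hj]
    have hx' (x : ℕ → V) (j : ℕ) (hj : j ≤ l) : (if j ≤ l then x j else 0) = x j := if_pos hj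
    have hs' (s : ℕ → K) (j : ℕ) (hj : j ≤ l) : (if j ≤ l then s j else 0) = s j := if_pos hj
    have hdom (x : ℕ → V) (s : ℕ → K) : directionMap K V l (x, s) + c ∈
        extDomain K (seqDomain K U l) ↔ (x, s) ∈ seqDomain K U (l + 1) := by
      rw [hA, seqDomain_succ, ← seqDomain_congr (hx' x) (hs' s),
        ← seqDomain_congr (hx x s) (hs s)]
      rfl
    refine ⟨⟨fun p => q (directionMap K V l p + c), ?_, ?_⟩, ?_⟩
    · have := hq.comp_affine (directionMap K V l) c
      rwa [show (fun x => directionMap K V l x + c) ⁻¹' extDomain K (seqDomain K U l) =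
        seqDomain K U (l + 1) from Set.ext fun p => hdom p.1 p.2] at this
    · intro x x' s s' hxx hss
      simp only [hA]
      rw [hxx (l + 1) le_rfl, hss (l + 1) le_rfl, hss l (by omega)]
      have h1 : (fun j => if j ≤ l then x j else 0) = fun j => if j ≤ l then x' j else 0 := by
        funext j; split_ifs with h
        · exact hxx j (by omega)
        · rfl
      have h2 : (fun j => if j ≤ l then s j else 0) = fun j => if j ≤ l then s' j else 0 := by
        funext j; split_ifs with h
        · exact hss j (by omega)
        · rfl
      rw [h1, h2]
    · intro x s hxs
      have hmem := (hdom x s).2 hxs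
      simp only
      rw [hA] at hmem ⊢
      rw [hqe _ _ _ hmem, ← hgl _ _ _ _ (hx x s) (hs s), ← hgl _ _ _ _ (hx' x) (hs' s)]
      rfl
  have base : P 0 fun p => f (p.1 0) := by
    refine ⟨?_, fun x x' s s' hx hs => by simp only [hx 0 le_rfl]⟩
    have := hf.comp_affine ((ContinuousLinearMap.proj 0).comp
      (ContinuousLinearMap.fst K (ℕ → V) (ℕ → K))) 0
    rw [show (fun p : (ℕ → V) × (ℕ → K) => (((ContinuousLinearMap.proj 0).comp
      (ContinuousLinearMap.fst K (ℕ → V) (ℕ → K))) p + 0 : V)) = fun p => p.1 0 from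
        funext fun p => add_zero _] at this
    rw [show seqDomain K U 0 = (fun p : (ℕ → V) × (ℕ → K) => p.1 0) ⁻¹' U by
      ext p; simp [seqDomain, newtonPoint_zero]]
    exact this.congr fun p _ => by simp
  choose next hnext using step
  let G (l : ℕ) : {g // P l g} := Nat.rec ⟨_, base⟩ next l
  exact ⟨fun l => (G l).1, fun l => (G l).2.1, fun l => (G l).2.2, fun _ _ => rfl,
    fun l => hnext l (G l)⟩

end Extension

/-! ### From tuples to sequences, and the nodes of Taylor's formula -/

section Padding

/-- Extension of a tuple by zero to a sequence. -/
def padZero {V : Type*} [Zero V] {n : ℕ} (x : Fin n → V) (j : ℕ) : V :=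
  if h : j < n then x ⟨j, h⟩ else 0

theorem padZero_val {V : Type*} [Zero V] {n : ℕ} (x : Fin n → V) (i : Fin n) :
    padZero x i = x i := by
  simp [padZero]

theorem padZero_nodes_zero {K : Type u} [CommRing K] {l : ℕ} :
    padZero (nodes (0 : Fin l → K)) = 0 := by
  funext j
  unfold padZero nodes
  split_ifs with h
  · rcases j with _ | j
    · rfl
    · rfl
  · rfl

theorem continuous_padZero {V : Type*} [Zero V] [TopologicalSpace V] {n : ℕ} :
    Continuous (padZero : (Fin n → V) → ℕ → V) := by
  refine continuous_pi fun j => ?_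
  unfold padZero
  split_ifs <;> fun_prop

theorem continuous_nodes {K : Type u} [CommRing K] [TopologicalSpace K] {l : ℕ} :
    Continuous (nodes : (Fin l → K) → Fin (l + 1) → K) := by
  refine continuous_pi fun i => ?_
  cases i using Fin.cases with
  | zero => simpa [nodes] using continuous_const
  | succ i => simpa [nodes] using continuous_apply i

variable {K : Type u} [CommRing K] {V : Type v} [AddCommGroup V] [Module K V]
  {W : Type w} [AddCommGroup W] [Module K W] {l : ℕ}

theorem simplexPoint_eq_newtonPoint (x : Fin (l + 1) → V) (s : Fin l → K) (i : Fin (l + 1)) :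
    simplexPoint x s i = newtonPoint (padZero x) (padZero (nodes s)) i := by
  have h1 (j : Fin (l + 1)) : ∏ m ∈ Iio j, (nodes s i - nodes s m) =
      ∏ m ∈ range j, (padZero (nodes s) i - padZero (nodes s) m) := by
    rw [← Nat.Iio_eq_range, ← Fin.map_valEmbedding_Iio, prod_map]
    simp only [Fin.valEmbedding_apply, padZero_val]
  unfold simplexPoint newtonPoint
  have h2 : range ((i : ℕ) + 1) = (Iic i).map Fin.valEmbedding := by
    rw [Fin.map_valEmbedding_Iic]; ext; simp
  rw [h2, sum_map]
  exact sum_congr rfl fun j _ => by rw [h1, Fin.valEmbedding_apply, padZero_val, padZero_val]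

theorem mem_simplicialDomain {U : Set V} {p : (Fin (l + 1) → V) × (Fin l → K)} :
    p ∈ simplicialDomain K l U ↔ (padZero p.1, padZero (nodes p.2)) ∈ seqDomain K U l := by
  constructor
  · intro h i hi
    simpa only [simplexPoint_eq_newtonPoint] using h ⟨i, by omega⟩
  · intro h i
    rw [simplexPoint_eq_newtonPoint]
    exact h i (by omega)

theorem dividedDiff_eq_seqDividedDiff (f : V → W) (p : (Fin (l + 1) → V) × (Fin l → K)) :
    dividedDiff f p = seqDividedDiff l (padZero (nodes p.2))
      fun i => f (newtonPoint (padZero p.1) (padZero (nodes p.2)) i) := by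
  unfold dividedDiff seqDividedDiff
  rw [sum_range]
  refine sum_congr rfl fun i _ => ?_
  rw [simplexPoint_eq_newtonPoint]
  have h : (range (l + 1)).erase i = (univ.erase i).map Fin.valEmbedding := by
    rw [map_erase, Fin.map_valEmbedding_univ, Nat.Iio_eq_range]; rfl
  rw [h, prod_map]
  simp only [Fin.valEmbedding_apply, padZero_val]

theorem isUnit_padZero_nodes {U : Set V} {p : (Fin (l + 1) → V) × (Fin l → K)}
    (hp : p ∈ nonsingularDomain K l U) :
    ∀ i ≤ l, ∀ j ≤ l, i ≠ j → IsUnit (padZero (nodes p.2) i - padZero (nodes p.2) j) := by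
  intro i hi j hj hij
  have := hp.2 ⟨i, by omega⟩ ⟨j, by omega⟩ (by simpa using hij)
  rwa [← padZero_val (nodes p.2), ← padZero_val (nodes p.2)] at this

theorem newtonPoint_nodes_zero {x : ℕ → V} {s : ℕ → K} {i : ℕ} (hs : ∀ j ≤ i, s j = 0) :
    newtonPoint x s i = x 0 := by
  unfold newtonPoint
  rw [sum_range_succ', sum_eq_zero, zero_add, prod_range_zero, one_smul]
  intro j hj
  rw [mem_range] at hj
  rw [prod_eq_zero (i := 0) (by simp), zero_smul]
  rw [hs i le_rfl, hs 0 (by omega), sub_zero]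

theorem mem_seqDomain_zero {U : Set V} {x : ℕ → V} (hx : x 0 ∈ U) (l : ℕ) :
    (x, (0 : ℕ → K)) ∈ seqDomain K U l := by
  intro i _
  have : newtonPoint x (0 : ℕ → K) i = x 0 := newtonPoint_nodes_zero fun _ _ => rfl
  simpa only [this] using hx

/-- The coefficients `x 0, …, x (N - 1), w, w, …`. -/
def taylorCoeff {V : Type*} (N : ℕ) (x : ℕ → V) (w : V) (j : ℕ) : V := if j < N then x j else w

/-- The nodes `0, …, 0, t, t, …` with `N` zeros. -/
def taylorNode {K : Type*} [Zero K] (N : ℕ) (t : K) (j : ℕ) : K := if j < N then 0 else t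

/-- With `N` zero nodes followed by `t`, the first `N` Newton points collapse to `x 0`, and the last
one is the polynomial with top coefficient `w`. -/
theorem taylor_mem_seqDomain {U : Set V} {N : ℕ} {x : ℕ → V} {w : V} {t : K} (hx : x 0 ∈ U)
    (h : ∑ j ∈ range N, t ^ j • x j + t ^ N • w ∈ U) :
    (taylorCoeff N x w, taylorNode N t) ∈ seqDomain K U N := by
  intro i hi
  rcases hi.lt_or_eq with hi | rfl
  · have : newtonPoint (taylorCoeff N x w) (taylorNode N t) i = x 0 := by
      exact (newtonPoint_nodes_zero fun j hj => if_pos (by omega)).trans (if_pos (by omega))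
    simpa only [this] using hx
  · have : newtonPoint (taylorCoeff i x w) (taylorNode i t) i =
        ∑ j ∈ range i, t ^ j • x j + t ^ i • w := by
      have hp : ∀ j ≤ i, ∏ m ∈ range j, (taylorNode i t i - taylorNode i t m) = t ^ j := by
        intro j hj
        rw [← card_range j, ← prod_const, card_range]
        refine prod_congr rfl fun m hm => ?_
        rw [mem_range] at hm
        rw [taylorNode, taylorNode, if_neg (by omega), if_pos (by omega), sub_zero]
      rw [newtonPoint, sum_range_succ, hp i le_rfl]
      congr 1
      · refine sum_congr rfl fun j hj => ?_
        rw [mem_range] at hj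
        rw [hp j hj.le, taylorCoeff, if_pos hj]
      · rw [taylorCoeff, if_neg (by omega)]
    simpa only [this] using h

end Padding

/-! ### Density of nonsingular nodes -/

section Density

variable {K : Type u} [CommRing K] [TopologicalSpace K] [IsTopologicalRing K]

/-- For one pair of nodes the condition is open, because units are open, and dense, because one of
the two nodes can be moved alone. A finite intersection of dense open sets is dense. -/
theorem dense_isUnit_nodes (ho : IsOpen {t : K | IsUnit t}) (hd : Dense {t : K | IsUnit t})
    (l : ℕ) :
    Dense {s : Fin l → K | ∀ i m, i ≠ m → IsUnit (nodes s i - nodes s m)} := by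
  have hcont (i m : Fin (l + 1)) : Continuous fun s : Fin l → K => nodes s i - nodes s m :=
    ((continuous_apply i).comp continuous_nodes).sub ((continuous_apply m).comp continuous_nodes)
  have hopen (i m : Fin (l + 1)) : IsOpen {s : Fin l → K | IsUnit (nodes s i - nodes s m)} :=
    ho.preimage (hcont i m)
  have hdense (a : Fin l) (m : Fin (l + 1)) (h : a.succ ≠ m) :
      Dense {s : Fin l → K | IsUnit (nodes s a.succ - nodes s m)} := by
    intro s
    -- The parameter `u` is exactly the difference of the two nodes after the move, and `s` itself
    -- occurs at the present difference.
    let φ : K → Fin l → K := fun u => Function.update s a (u + nodes s m)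
    have hφ : Continuous φ := continuous_const.update a (by fun_prop)
    have h0 : φ (nodes s a.succ - nodes s m) = s := by
      simp [φ, nodes]
    rw [← h0]
    refine map_mem_closure hφ (hd _) fun u hu => ?_
    have h1 : nodes (φ u) m = nodes s m := by
      cases m using Fin.cases with
      | zero => simp [nodes]
      | succ b =>
        have : b ≠ a := fun e => h (by rw [e])
        simp [nodes, φ, Function.update_of_ne this]
    have h2 : nodes (φ u) a.succ = u + nodes s m := by
      simp [nodes, φ]
    simpa only [Set.mem_ofPred_eq, h1, h2, add_sub_cancel_right] using hu
  have hdense' (i m : Fin (l + 1)) (h : i ≠ m) :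
      Dense {s : Fin l → K | IsUnit (nodes s i - nodes s m)} := by
    cases i using Fin.cases with
    | succ a => exact hdense a m h
    | zero =>
      cases m using Fin.cases with
      | zero => exact absurd rfl h
      | succ b => simpa only [IsUnit.sub_iff] using hdense b 0 h.symm
  have key (S : Finset (Fin (l + 1) × Fin (l + 1))) :
      IsOpen {s : Fin l → K | ∀ q ∈ S, q.1 ≠ q.2 → IsUnit (nodes s q.1 - nodes s q.2)} ∧
      Dense {s : Fin l → K | ∀ q ∈ S, q.1 ≠ q.2 → IsUnit (nodes s q.1 - nodes s q.2)} := by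
    induction S using Finset.induction_on with
    | empty => simp
    | insert q S _ ih =>
      by_cases hq : q.1 = q.2
      · simpa [hq] using ih
      · have e : {s : Fin l → K | ∀ r ∈ insert q S, r.1 ≠ r.2 →
            IsUnit (nodes s r.1 - nodes s r.2)} =
            {s | IsUnit (nodes s q.1 - nodes s q.2)} ∩
              {s | ∀ r ∈ S, r.1 ≠ r.2 → IsUnit (nodes s r.1 - nodes s r.2)} := by
          ext s; simp [hq]
        rw [e]
        exact ⟨(hopen _ _).inter ih.1,
          (hdense' _ _ hq).inter_of_isOpen_left ih.2 (hopen _ _)⟩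
  refine (key univ).2.mono fun s hs i m h => ?_
  simp only [Set.mem_ofPred_eq] at hs
  exact hs (i, m) (mem_univ _) h

variable {V : Type v} [AddCommGroup V] [Module K V] [TopologicalSpace V]
  [IsTopologicalAddGroup V] [ContinuousSMul K V]

theorem simplicialDomain_subset_closure (ho : IsOpen {t : K | IsUnit t})
    (hd : Dense {t : K | IsUnit t}) {U : Set V} (hU : IsOpen U) (l : ℕ) :
    simplicialDomain K l U ⊆ closure (nonsingularDomain K l U) := by
  have hopen : IsOpen (simplicialDomain K l U) := by
    have : simplicialDomain K l U =
        (fun p : (Fin (l + 1) → V) × (Fin l → K) => (padZero p.1, padZero (nodes p.2))) ⁻¹'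
          seqDomain K U l := Set.ext fun p => mem_simplicialDomain
    rw [this]
    exact (isOpen_seqDomain hU l).preimage ((continuous_padZero.comp continuous_fst).prodMk
      (continuous_padZero.comp (continuous_nodes.comp continuous_snd)))
  have hdense := (dense_univ (X := Fin (l + 1) → V)).prod (dense_isUnit_nodes ho hd l)
  refine (hdense.open_subset_closure_inter hopen).trans (closure_mono ?_)
  rintro p ⟨hp, -, hs⟩
  exact ⟨hp, hs⟩

end Density

/-! ### Divided differences, Taylor's formula and the jet map -/

section Extension

variable {K : Type u} [CommRing K] [TopologicalSpace K]
  {V : Type (max u v)} [AddCommGroup V] [Module K V] [TopologicalSpace V]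
  {W : Type w} [AddCommGroup W] [Module K W] [TopologicalSpace W]
  {U : Set V} {f : V → W} {G : ℕ → (ℕ → V) × (ℕ → K) → W}

/-- Both sides satisfy the same recursion, and at nonsingular nodes the factor `s (l + 1) - s l` can
be cancelled. -/
theorem IsExtension.eq_seqDividedDiff (h : IsExtension.{u, v, w} U f G) (l : ℕ) :
    ∀ (x : ℕ → V) (s : ℕ → K), (x, s) ∈ seqDomain K U l →
    (∀ i ≤ l, ∀ j ≤ l, i ≠ j → IsUnit (s i - s j)) →
    G l (x, s) = seqDividedDiff l s fun i => f (newtonPoint x s i) := by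
  induction l with
  | zero =>
    intro x s _ _
    rw [h.zero]
    simp [seqDividedDiff, newtonPoint_zero]
  | succ l ih =>
    intro x s hxs hs
    have hu : IsUnit (s (l + 1) - s l) := hs _ le_rfl _ (by omega) (by omega)
    rw [← hu.smul_left_cancel, h.succ l x s hxs, seqDividedDiff_succ _ hs]
    obtain ⟨hd, hd'⟩ := seqDomain_succ.1 hxs
    rw [ih x s hd fun i hi j hj => hs i (by omega) j (by omega), ih _ _ hd' ?_]
    · congr 1
      refine seqDividedDiff_congr fun i hi => ?_
      rcases hi.lt_or_eq with hi | rfl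
      · rw [newtonPoint_shift_of_lt _ _ hi, Function.update_of_ne (by omega)]
      · rw [newtonPoint_shift_self, Function.update_self]
    · intro i hi j hj hij
      unfold shiftNode
      by_cases h1 : i = l
      · subst h1
        rw [Function.update_self, Function.update_of_ne (by omega)]
        exact hs _ le_rfl j (by omega) (by omega)
      · by_cases h2 : j = l
        · subst h2
          rw [Function.update_self, Function.update_of_ne (by omega)]
          exact hs _ (by omega) _ le_rfl (by omega)
        · rw [Function.update_of_ne h1, Function.update_of_ne h2]
          exact hs _ (by omega) _ (by omega) hij

theorem IsExtension.continuousOn_padZero (h : IsExtension.{u, v, w} U f G) (l : ℕ) :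
    ContinuousOn (fun p : (Fin (l + 1) → V) × (Fin l → K) =>
      G l (padZero p.1, padZero (nodes p.2))) (simplicialDomain K l U) :=
  (h.smooth l).continuousOn.comp (t := seqDomain K U l) ((continuous_padZero.comp
    continuous_fst).prodMk (continuous_padZero.comp
      (continuous_nodes.comp continuous_snd))).continuousOn fun _ hp => mem_simplicialDomain.1 hp

theorem IsExtension.eqOn_dividedDiff (h : IsExtension.{u, v, w} U f G) (l : ℕ) :
    Set.EqOn (fun p : (Fin (l + 1) → V) × (Fin l → K) =>
      G l (padZero p.1, padZero (nodes p.2))) (dividedDiff f) (nonsingularDomain K l U) := by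
  intro p hp
  rw [dividedDiff_eq_seqDividedDiff]
  exact h.eq_seqDividedDiff l _ _ (mem_simplicialDomain.1 hp.1) (isUnit_padZero_nodes hp)

theorem IsExtension.isSimplicialC (h : IsExtension.{u, v, w} U f G) (k : ℕ) :
    IsSimplicialC K k U f :=
  fun l _ => ⟨_, h.continuousOn_padZero l, h.eqOn_dividedDiff l⟩

/-- Induction on `N` with `w` free: the recursion at nodes `0, …, 0, t` splits the remainder of
order `N` into the next coefficient and `t` times the next remainder. -/
theorem IsExtension.taylor (h : IsExtension.{u, v, w} U f G) {x : ℕ → V} (hx : x 0 ∈ U) (t : K)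
    (N : ℕ) : ∀ w : V, ∑ j ∈ range N, t ^ j • x j + t ^ N • w ∈ U →
      f (∑ j ∈ range N, t ^ j • x j + t ^ N • w) =
        ∑ j ∈ range N, t ^ j • G j (x, 0) +
          t ^ N • G N (taylorCoeff N x w, taylorNode N t) := by
  induction N with
  | zero =>
    intro w _
    simp [h.zero, taylorCoeff]
  | succ N ih =>
    intro w hw
    -- The induction hypothesis is used with `x N + t • w` in place of `w`, which is the shifted
    -- coefficient in the recursion.
    have e : ∑ j ∈ range (N + 1), t ^ j • x j + t ^ (N + 1) • w =
        ∑ j ∈ range N, t ^ j • x j + t ^ N • (x N + t • w) := by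
      rw [sum_range_succ, smul_add, smul_smul, pow_succ, add_assoc]
    have hmem := taylor_mem_seqDomain hx hw
    rw [e] at hw ⊢
    rw [ih _ hw, sum_range_succ, add_assoc, pow_succ, mul_smul, ← smul_add]
    congr 2
    have := h.succ N _ _ hmem
    have h1 : taylorNode (N + 1) t (N + 1) - taylorNode (N + 1) t N = t := by
      simp [taylorNode]
    have h2 : G N (taylorCoeff (N + 1) x w, taylorNode (N + 1) t) = G N (x, 0) :=
      h.congr _ _ _ _ _ (fun j hj => if_pos (by omega)) fun j hj => if_pos (by omega)
    rw [h1, h2, eq_sub_iff_add_eq'] at this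
    rw [this]
    refine h.congr _ _ _ _ _ (fun j hj => ?_) fun j hj => ?_
    · rcases hj.lt_or_eq with hj | rfl
      · rw [shiftCoeff, Function.update_of_ne (by omega), taylorCoeff, taylorCoeff, if_pos hj,
          if_pos (by omega)]
      · rw [shiftCoeff, h1, Function.update_self]
        simp [taylorCoeff]
    · rcases hj.lt_or_eq with hj | rfl
      · rw [shiftNode, Function.update_of_ne (by omega), taylorNode, taylorNode, if_pos hj,
          if_pos (by omega)]
      · rw [shiftNode, Function.update_self]
        simp [taylorNode]

variable [IsTopologicalRing K] [IsTopologicalAddGroup V] [ContinuousSMul K V]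

/-- The coefficients of a jet as a sequence. -/
def jetSeq {V : Type*} [Zero V] {k : ℕ} (x : JetModule k V) : ℕ → V :=
  padZero (n := k + 1) x

/-- The jet is defined by limits from nonsingular arguments. These accumulate at the zero nodes, and
`G l` is continuous there and agrees with the divided difference off the singular set. -/
theorem IsExtension.jetMap_apply [T2Space W] (h : IsExtension.{u, v, w} U f G)
    (ho : IsOpen {t : K | IsUnit t}) (hd : Dense {t : K | IsUnit t}) (hU : IsOpen U) {k : ℕ}
    {x : JetModule k V} (hx : x ∈ jetDomain k U) (l : Fin (k + 1)) :
    jetMap K k U f x l = G l (jetSeq x, 0) := by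
  let y : Fin ((l : ℕ) + 1) → V :=
    fun j => x (Fin.castLE (Nat.succ_le_succ (Nat.le_of_lt_succ l.2)) j)
  have hmem : (y, (0 : Fin l → K)) ∈ simplicialDomain K (l : ℕ) U := by
    rw [mem_simplicialDomain, padZero_nodes_zero]
    exact mem_seqDomain_zero hx _
  have h1 : jetMap K k U f x l = G l (padZero y, padZero (nodes (0 : Fin l → K))) := by
    refine extendFrom_eq (simplicialDomain_subset_closure ho hd hU _ hmem) ?_
    have := ((h.continuousOn_padZero l) _ hmem).mono
      (fun _ hp => hp.1 : nonsingularDomain K (l : ℕ) U ⊆ _)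
    exact this.tendsto.congr' ((h.eqOn_dividedDiff l).eventuallyEq_of_mem self_mem_nhdsWithin)
  rw [h1, padZero_nodes_zero]
  refine h.congr _ _ _ _ _ (fun j hj => ?_) fun _ _ => rfl
  have hl := l.2
  have h2 : j < (l : ℕ) + 1 := by omega
  have h3 : j < k + 1 := by omega
  simp only [jetSeq, padZero, dif_pos h2, dif_pos h3]
  rfl

theorem IsExtension.continuousOn_jetMap [T2Space W] (h : IsExtension.{u, v, w} U f G)
    (ho : IsOpen {t : K | IsUnit t}) (hd : Dense {t : K | IsUnit t}) (hU : IsOpen U) (k : ℕ) :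
    ContinuousOn (jetMap K k U f) (jetDomain k U) := by
  refine continuousOn_pi.2 fun l => ?_
  have : ContinuousOn (fun x : JetModule k V => G l (jetSeq x, 0)) (jetDomain k U) := by
    refine (h.smooth l).continuousOn.comp (t := seqDomain K U l)
      (continuous_padZero.prodMk continuous_const).continuousOn
      fun x hx => mem_seqDomain_zero hx l
  exact this.congr fun x hx => h.jetMap_apply ho hd hU hx l

end Extension

/-! ### Taylor expansions of curves -/

section Taylor

variable {K : Type u} [CommRing K] [TopologicalSpace K] [IsTopologicalRing K]
  {W : Type w} [AddCommGroup W] [Module K W] [TopologicalSpace W]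
  [IsTopologicalAddGroup W] [ContinuousSMul K W]

/-- The curve `γ` has the expansion `∑ l < N, t ^ l a_l + t ^ N r(t)` near `0`, with `r`
continuous at `0`. -/
def HasTaylor (γ : K → W) (N : ℕ) (a : ℕ → W) : Prop :=
  ∃ r : K → W, ContinuousAt r 0 ∧
    ∀ᶠ t in 𝓝 (0 : K), γ t = ∑ l ∈ range N, t ^ l • a l + t ^ N • r t

variable {γ γ' : K → W} {N : ℕ} {a b : ℕ → W}

theorem sum_pow_smul_succ' (t : K) (N : ℕ) (a : ℕ → W) (r : W) :
    ∑ l ∈ range (N + 1), t ^ l • a l + t ^ (N + 1) • r =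
      a 0 + t • (∑ l ∈ range N, t ^ l • a (l + 1) + t ^ N • r) := by
  rw [sum_range_succ', smul_add, smul_sum, smul_smul, ← pow_succ', pow_zero, one_smul]
  simp only [smul_smul, ← pow_succ']
  abel

/-- The limit at `0` gives the constant term; it is subtracted and one factor `t` is cancelled,
which is why `t` runs through units only. -/
theorem taylor_unique_aux [T2Space W] [(𝓝[{t : K | IsUnit t}] 0).NeBot] {N : ℕ} :
    ∀ {a b : ℕ → W} {r q : K → W}, ContinuousAt r 0 → ContinuousAt q 0 →
    (∀ᶠ t in 𝓝[{t : K | IsUnit t}] 0, ∑ l ∈ range N, t ^ l • a l + t ^ N • r t =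
      ∑ l ∈ range N, t ^ l • b l + t ^ N • q t) → ∀ l < N, a l = b l := by
  induction N with
  | zero => intro _ _ _ _ _ _ _ l hl; omega
  | succ N ih =>
    intro a b r q hr hq h
    have hlim (a : ℕ → W) (r : K → W) (hr : ContinuousAt r 0) :
        Tendsto (fun t : K => ∑ l ∈ range (N + 1), t ^ l • a l + t ^ (N + 1) • r t)
          (𝓝[{t : K | IsUnit t}] 0) (𝓝 (a 0)) := by
      have hc : ContinuousAt
          (fun t : K => ∑ l ∈ range (N + 1), t ^ l • a l + t ^ (N + 1) • r t) 0 :=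
        (Continuous.continuousAt (by fun_prop)).add ((continuous_pow _).continuousAt.smul hr)
      have := hc.tendsto
      rw [sum_pow_smul_succ', zero_smul, add_zero] at this
      exact this.mono_left nhdsWithin_le_nhds
    have h0 : a 0 = b 0 := tendsto_nhds_unique_of_eventuallyEq (hlim a r hr) (hlim b q hq) h
    intro l hl
    rcases l with _ | l
    · exact h0
    · refine ih hr hq ?_ l (by omega) (a := fun l => a (l + 1)) (b := fun l => b (l + 1))
      filter_upwards [h, self_mem_nhdsWithin] with t ht (hu : IsUnit t)
      rwa [sum_pow_smul_succ', sum_pow_smul_succ', h0, add_right_inj, hu.smul_left_cancel] at ht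

theorem HasTaylor.unique [T2Space W] (hd : Dense {t : K | IsUnit t})
    (h : HasTaylor γ N a) (h' : HasTaylor γ N b) {l : ℕ} (hl : l < N) : a l = b l := by
  obtain ⟨r, hr, h⟩ := h
  obtain ⟨q, hq, h'⟩ := h'
  have := mem_closure_iff_nhdsWithin_neBot.1 (hd 0)
  refine taylor_unique_aux hr hq ?_ l hl
  filter_upwards [nhdsWithin_le_nhds h, nhdsWithin_le_nhds h'] with t h1 h2
  rw [← h1, h2]

theorem HasTaylor.congr (h : HasTaylor γ N a) (hγ : γ' =ᶠ[𝓝 0] γ) : HasTaylor γ' N a := by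
  obtain ⟨r, hr, h⟩ := h
  exact ⟨r, hr, by filter_upwards [h, hγ] with t h1 h2; rw [h2, h1]⟩

theorem HasTaylor.congr_coeff (h : HasTaylor γ N a) (hb : ∀ l < N, b l = a l) :
    HasTaylor γ N b := by
  obtain ⟨r, hr, h⟩ := h
  refine ⟨r, hr, ?_⟩
  filter_upwards [h] with t h1
  rw [h1, sum_congr rfl fun l hl => congrArg (t ^ l • ·) (hb l (mem_range.1 hl)).symm]

theorem hasTaylor_sum_pow_smul (N : ℕ) (a : ℕ → W) :
    HasTaylor (fun t : K => ∑ l ∈ range N, t ^ l • a l) N a :=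
  ⟨0, continuousAt_const, by simp⟩

theorem HasTaylor.continuousAt (h : HasTaylor γ N a) : ContinuousAt γ 0 := by
  obtain ⟨r, hr, h⟩ := h
  have hc : ContinuousAt (fun t : K => ∑ l ∈ range N, t ^ l • a l + t ^ N • r t) 0 :=
    (Continuous.continuousAt (by fun_prop)).add ((continuous_pow _).continuousAt.smul hr)
  exact hc.congr (h.mono fun _ h => h.symm)

theorem HasTaylor.apply_zero (h : HasTaylor γ N a) (hN : 0 < N) : γ 0 = a 0 := by
  obtain ⟨r, -, h⟩ := h
  obtain ⟨N, rfl⟩ := Nat.exists_eq_add_one_of_ne_zero hN.ne'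
  have := h.self_of_nhds
  rwa [sum_pow_smul_succ', zero_smul, add_zero] at this

theorem HasTaylor.add (h : HasTaylor γ N a) (h' : HasTaylor γ' N b) :
    HasTaylor (fun t => γ t + γ' t) N (fun l => a l + b l) := by
  obtain ⟨r, hr, h⟩ := h
  obtain ⟨q, hq, h'⟩ := h'
  refine ⟨fun t => r t + q t, hr.add hq, ?_⟩
  filter_upwards [h, h'] with t h1 h2
  simp only [h1, h2, smul_add, sum_add_distrib]
  abel

theorem HasTaylor.const_smul (h : HasTaylor γ N a) (c : K) :
    HasTaylor (fun t => c • γ t) N (fun l => c • a l) := by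
  obtain ⟨r, hr, h⟩ := h
  refine ⟨fun t => c • r t, continuousAt_const.smul hr, ?_⟩
  filter_upwards [h] with t h1
  simp only [h1, smul_add, smul_sum, smul_comm c]

theorem HasTaylor.sub (h : HasTaylor γ N a) (h' : HasTaylor γ' N b) :
    HasTaylor (fun t => γ t - γ' t) N (fun l => a l - b l) := by
  simpa only [neg_one_smul, ← sub_eq_add_neg] using h.add (h'.const_smul (-1))

theorem hasTaylor_zero : HasTaylor (fun _ : K => (0 : W)) N (fun _ => 0) :=
  ⟨0, continuousAt_const, by simp⟩

theorem HasTaylor.sum {ι : Type*} (S : Finset ι) {γ : ι → K → W} {a : ι → ℕ → W}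
    (h : ∀ i ∈ S, HasTaylor (γ i) N (a i)) :
    HasTaylor (fun t => ∑ i ∈ S, γ i t) N (fun l => ∑ i ∈ S, a i l) := by
  classical
  induction S using Finset.induction_on with
  | empty => simpa using hasTaylor_zero (K := K) (W := W) (N := N)
  | insert i S hi ih =>
    simp only [sum_insert hi]
    exact (h i (mem_insert_self i S)).add (ih fun j hj => h j (mem_insert_of_mem hj))

theorem HasTaylor.id_smul (h : HasTaylor γ N a) :
    HasTaylor (fun t => t • γ t) N (fun l => if l = 0 then 0 else a (l - 1)) := by
  obtain ⟨r, hr, h⟩ := h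
  rcases N with _ | N
  · refine ⟨fun t => t • r t, continuousAt_id.smul hr, ?_⟩
    filter_upwards [h] with t h1
    rw [h1]
    simp
  -- The old top coefficient now has degree `N + 1` and is absorbed into the remainder.
  · refine ⟨fun t => a N + t • r t, continuousAt_const.add (continuousAt_id.smul hr), ?_⟩
    filter_upwards [h] with t h1
    rw [sum_pow_smul_succ', h1, sum_range_succ]
    simp [smul_add, pow_succ, mul_smul, add_assoc]

theorem HasTaylor.pow_smul (h : HasTaylor γ N a) (i : ℕ) :
    HasTaylor (fun t => t ^ i • γ t) N (fun l => if l < i then 0 else a (l - i)) := by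
  induction i with
  | zero => simpa using h
  | succ i ih =>
    simp only [pow_succ', mul_smul]
    refine ih.id_smul.congr_coeff fun l _ => ?_
    rcases l with _ | l
    · simp
    · simp

/-- The Cauchy product: multiplying curves corresponds to the truncated action of the jet ring on
jets. -/
theorem HasTaylor.polynomial_smul (h : HasTaylor γ N a) (c : ℕ → K) :
    HasTaylor (fun t => (∑ i ∈ range N, t ^ i • c i) • γ t) N
      (fun l => ∑ p ∈ antidiagonal l, c p.1 • a p.2) := by
  have h1 := HasTaylor.sum (range N) fun i _ => (h.pow_smul i).const_smul (c i)
  have h2 : HasTaylor (fun t => (∑ i ∈ range N, t ^ i • c i) • γ t) N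
      (fun l => ∑ i ∈ range N, c i • if l < i then 0 else a (l - i)) := by
    refine h1.congr (.of_forall fun t => ?_)
    simp only [sum_smul, smul_smul, smul_eq_mul, mul_comm (c _)]
  refine h2.congr_coeff fun l hl => ?_
  · rw [Nat.sum_antidiagonal_eq_sum_range_succ (fun i j => c i • a j)]
    refine sum_subset_zero_on_sdiff (range_subset_range.2 hl) ?_ ?_
    · intro i hi
      rw [Finset.mem_sdiff, mem_range, mem_range] at hi
      rw [if_pos (by omega), smul_zero]
    · intro i hi
      rw [mem_range] at hi
      rw [if_neg (by omega)]

end Taylor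

/-! ### The jet as Taylor expansion along curves -/

section Chain

variable {K : Type u} [CommRing K] [TopologicalSpace K] [IsTopologicalRing K]
  {V : Type (max u v)} [AddCommGroup V] [Module K V] [TopologicalSpace V]
  [IsTopologicalAddGroup V] [ContinuousSMul K V]
  {W : Type w} [AddCommGroup W] [Module K W] [TopologicalSpace W]
  [IsTopologicalAddGroup W] [ContinuousSMul K W] {U : Set V} {f : V → W} {G : ℕ → (ℕ → V) × (ℕ → K) → W}

/-- Taylor's formula is applied with `w` equal to the remainder of `γ` at `t`; continuity of `G N`
then gives that of the new remainder. -/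
theorem IsExtension.hasTaylor_comp (h : IsExtension.{u, v, w} U f G) (hU : IsOpen U)
    {γ : K → V} {N : ℕ} {x : ℕ → V} (hγ : HasTaylor γ N x) (hN : 0 < N) (hx : x 0 ∈ U) :
    HasTaylor (fun t => f (γ t)) N fun l => G l (x, 0) := by
  have hγU : ∀ᶠ t in 𝓝 (0 : K), γ t ∈ U :=
    hγ.continuousAt.eventually (hU.mem_nhds (by rwa [hγ.apply_zero hN]))
  obtain ⟨r, hr, hγ⟩ := hγ
  refine ⟨fun t => G N (taylorCoeff N x (r t), taylorNode N t), ?_, ?_⟩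
  · have hc : ContinuousAt (fun t : K => (taylorCoeff N x (r t), taylorNode N t)) 0 := by
      refine (continuousAt_pi.2 fun j => ?_).prodMk (continuousAt_pi.2 fun j => ?_)
      · unfold taylorCoeff; split_ifs
        · exact continuousAt_const
        · exact hr
      · unfold taylorNode; split_ifs
        · exact continuousAt_const
        · exact continuousAt_id
    have hmem := taylor_mem_seqDomain hx (N := N) (w := r 0) (t := (0 : K)) (by
      have := hγ.self_of_nhds
      rw [← this]; exact hγU.self_of_nhds)
    exact ContinuousAt.comp (f := fun t : K => (taylorCoeff N x (r t), taylorNode N t))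
      ((h.smooth N).continuousOn.continuousAt ((isOpen_seqDomain hU N).mem_nhds hmem)) hc
  · filter_upwards [hγ, hγU] with t h1 h2
    rw [h1] at h2 ⊢
    exact h.taylor hx t N _ h2

variable [T2Space W]

/-- The simplicial jet of a smooth map is its Taylor expansion along curves. -/
theorem IsSmooth.hasTaylor_comp (hf : IsSmooth.{u, v, w} K U f)
    (ho : IsOpen {t : K | IsUnit t}) (hd : Dense {t : K | IsUnit t}) (hU : IsOpen U)
    {γ : K → V} {k : ℕ} {x : JetModule k V} (hγ : HasTaylor γ (k + 1) (jetSeq x))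
    (hx : x ∈ jetDomain k U) :
    HasTaylor (fun t => f (γ t)) (k + 1) (jetSeq (jetMap K k U f x)) := by
  obtain ⟨G, hG⟩ := hf.exists_extension.{u, v, w} hd hU
  refine (hG.hasTaylor_comp hU hγ (Nat.succ_pos k) hx).congr_coeff fun l hl => ?_
  rw [← hG.jetMap_apply ho hd hU hx ⟨l, hl⟩]
  exact dif_pos hl

theorem jetSeq_val {V : Type*} [Zero V] {k : ℕ} (x : JetModule k V) (i : Fin (k + 1)) :
    jetSeq x i = x i := padZero_val (n := k + 1) x i

theorem hasTaylor_const {W : Type w} [AddCommGroup W] [Module K W] [TopologicalSpace W]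
    [IsTopologicalAddGroup W] [ContinuousSMul K W] (k : ℕ) (x : W) :
    HasTaylor (fun _ : K => x) (k + 1) (jetSeq (jetBase k x)) := by
  refine (hasTaylor_sum_pow_smul (k + 1) _).congr (.of_forall fun t => ?_)
  refine Eq.symm ?_
  simp only
  rw [sum_range_succ', sum_eq_zero]
  · simp [jetSeq, padZero, jetBase]
  · intro l _
    simp [jetSeq, padZero, jetBase]

/-- Along a constant curve `f` is constant; uniqueness of Taylor coefficients does the rest. -/
theorem jetMap_jetBase (hf : IsSmooth.{u, v, w} K U f)
    (ho : IsOpen {t : K | IsUnit t}) (hd : Dense {t : K | IsUnit t}) (hU : IsOpen U)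
    (k : ℕ) {x : V} (hx : x ∈ U) :
    jetMap K k U f (jetBase k x) = jetBase k (f x) := by
  have h1 := hf.hasTaylor_comp ho hd hU (hasTaylor_const k x) (by simpa [jetDomain, jetBase])
  funext l
  have := h1.unique hd (hasTaylor_const k (f x)) l.2
  simpa only [jetSeq_val] using this

end Chain

/-! ### Topology on jet rings and jet modules -/

theorem continuous_jetRing_apply {K : Type*} [TopologicalSpace K] {k : ℕ} (i : Fin (k + 1)) :
    Continuous fun a : JetRing K k => a i :=
  continuous_apply (A := fun _ : Fin (k + 1) => K) i

theorem continuous_jetModule_apply {V : Type*} [TopologicalSpace V] {k : ℕ} (i : Fin (k + 1)) :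
    Continuous fun x : JetModule k V => x i :=
  continuous_apply (A := fun _ : Fin (k + 1) => V) i

section Instances

variable {K : Type u} [CommRing K] [TopologicalSpace K] [IsTopologicalRing K]
  {V : Type v} [AddCommGroup V] [Module K V] [TopologicalSpace V]
  [IsTopologicalAddGroup V] [ContinuousSMul K V] {k : ℕ}

instance : IsTopologicalAddGroup (JetModule k V) :=
  inferInstanceAs (IsTopologicalAddGroup (Fin (k + 1) → V))

instance [T2Space V] : T2Space (JetModule k V) :=
  inferInstanceAs (T2Space (Fin (k + 1) → V))

instance : ContinuousSMul (JetRing K k) (JetModule k V) where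
  continuous_smul := continuous_pi fun l => continuous_finsetSum (pairs l) fun p _ =>
    ((continuous_jetRing_apply p.1).comp continuous_fst).smul
      ((continuous_jetModule_apply p.2).comp continuous_snd)

instance : IsTopologicalRing (JetRing K k) where
  continuous_add := continuous_add (M := Fin (k + 1) → K)
  continuous_neg := continuous_neg (G := Fin (k + 1) → K)
  continuous_mul := continuous_pi fun l => continuous_finsetSum (pairs l) fun p _ =>
    ((continuous_jetRing_apply p.1).comp continuous_fst).mul
      ((continuous_jetRing_apply p.2).comp continuous_snd)

end Instances

/-! ### Smoothness of the jet map over the jet ring -/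

section Quotient

variable {K : Type u} [CommRing K] [TopologicalSpace K] [IsTopologicalRing K]
  {V : Type (max u v)} [AddCommGroup V] [Module K V] [TopologicalSpace V]
  [IsTopologicalAddGroup V] [ContinuousSMul K V]
  {W : Type w} [AddCommGroup W] [Module K W] [TopologicalSpace W]
  [IsTopologicalAddGroup W] [ContinuousSMul K W] [T2Space W] {U : Set V} {k : ℕ}

theorem jetSeq_add {V : Type*} [AddCommGroup V] (x y : JetModule k V) (j : ℕ) :
    jetSeq (x + y) j = jetSeq x j + jetSeq y j := by
  unfold jetSeq padZero
  split_ifs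
  · rfl
  · simp

theorem jetSeq_smul {V : Type*} [AddCommGroup V] [Module K V] (s : JetRing K k)
    (y : JetModule k V) {l : ℕ} (hl : l < k + 1) :
    jetSeq (s • y) l =
      ∑ p ∈ antidiagonal l, jetSeq (V := K) (k := k) s p.1 • jetSeq y p.2 := by
  rw [← sum_pairs ⟨l, hl⟩ fun i j => jetSeq (V := K) (k := k) s i • jetSeq y j]
  refine (dif_pos hl).trans (sum_congr rfl fun p _ => ?_)
  rw [jetSeq_val, show jetSeq (V := K) (k := k) s p.1 = s p.1 from padZero_val (n := k + 1) s p.1]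

/-- The map `J^k V × J^k V × J^k K → J^k (V × V × K)`. -/
def jetProd (k : ℕ) (V : Type v) [AddCommGroup V] [Module K V] [TopologicalSpace V] :
    (JetModule k V × JetModule k V × JetRing K k) →L[JetRing K k] JetModule k (V × V × K) where
  toFun p j := (p.1 j, p.2.1 j, p.2.2 j)
  map_add' _ _ := rfl
  map_smul' s p := by
    funext l
    refine Prod.ext ?_ (Prod.ext ?_ ?_)
    · exact (Prod.fst_sum (s := pairs l) (f := fun q => s q.1 •
        (p.1 q.2, p.2.1 q.2, p.2.2 q.2))).symm
    · exact ((congrArg Prod.fst (Prod.snd_sum (s := pairs l) (f := fun q => s q.1 •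
        (p.1 q.2, p.2.1 q.2, p.2.2 q.2)))).trans Prod.fst_sum).symm
    · exact ((congrArg Prod.snd (Prod.snd_sum (s := pairs l) (f := fun q => s q.1 •
        (p.1 q.2, p.2.1 q.2, p.2.2 q.2)))).trans Prod.snd_sum).symm
  cont := continuous_pi fun j => ((continuous_jetModule_apply j).comp continuous_fst).prodMk
    (((continuous_jetModule_apply j).comp (continuous_fst.comp continuous_snd)).prodMk
      ((continuous_jetRing_apply j).comp (continuous_snd.comp continuous_snd)))

theorem jetModule_smul_zero {V : Type*} [AddCommGroup V] [Module K V] (s : JetRing K k)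
    (y : JetModule k V) : (s • y) 0 = s 0 • y 0 := by
  have := jetSeq_smul s y (Nat.succ_pos k)
  simpa [jetSeq, padZero] using this

/-- Both conditions involve only the coefficients of degree zero, where the jet action is the action
of `K`. -/
theorem extDomain_jetDomain (U : Set V) :
    extDomain (JetRing K k) (jetDomain k U) =
      jetProd k V ⁻¹' jetDomain k (extDomain K U) := by
  ext p
  have : (p.1 + p.2.2 • p.2.1) 0 = p.1 0 + p.2.2 0 • p.2.1 0 :=
    congrArg (p.1 0 + ·) (jetModule_smul_zero p.2.2 p.2.1)
  change _ ∧ (p.1 + p.2.2 • p.2.1) 0 ∈ U ↔ _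
  rw [this]
  rfl

/-- The jet of the difference quotient is the difference quotient of the jet. -/
theorem smul_jetMap_quotient (ho : IsOpen {t : K | IsUnit t}) (hd : Dense {t : K | IsUnit t})
    (hU : IsOpen U) {f : V → W} (hf : IsSmooth.{u, v, w} K U f) {g : V × V × K → W}
    (hg : IsSmooth.{u, v, w} K (extDomain K U) g)
    (hgf : ∀ x y t, (x, y, t) ∈ extDomain K U → t • g (x, y, t) = f (x + t • y) - f x)
    {p : JetModule k V × JetModule k V × JetRing K k}
    (hp : p ∈ extDomain (JetRing K k) (jetDomain k U)) :
    p.2.2 • jetMap K k (extDomain K U) g (jetProd k V p) =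
      jetMap K k U f (p.1 + p.2.2 • p.2.1) - jetMap K k U f p.1 := by
  obtain ⟨x, y, s⟩ := p
  let c : ℕ → K := jetSeq (V := K) (k := k) s
  let γx : K → V := fun t => ∑ l ∈ range (k + 1), t ^ l • jetSeq x l
  let γy : K → V := fun t => ∑ l ∈ range (k + 1), t ^ l • jetSeq y l
  let γs : K → K := fun t => ∑ l ∈ range (k + 1), t ^ l • c l
  have hx : HasTaylor γx (k + 1) (jetSeq x) := hasTaylor_sum_pow_smul _ _
  have hy : HasTaylor γy (k + 1) (jetSeq y) := hasTaylor_sum_pow_smul _ _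
  have hz : HasTaylor (fun t => (γx t, γy t, γs t)) (k + 1) (jetSeq (jetProd k V (x, y, s))) := by
    refine (hasTaylor_sum_pow_smul (k + 1) _).congr (.of_forall fun t => ?_)
    have (l : ℕ) : jetSeq (jetProd k V (x, y, s)) l = (jetSeq x l, jetSeq y l, c l) := by
      simp only [c, jetSeq, padZero]
      split_ifs
      · rfl
      · rfl
    simp only [this]
    refine Prod.ext ?_ (Prod.ext ?_ ?_) <;> simp [Prod.fst_sum, Prod.snd_sum, γx, γy, γs]
  have hxy : HasTaylor (fun t => γx t + γs t • γy t) (k + 1) (jetSeq (x + s • y)) :=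
    (hx.add (hy.polynomial_smul c)).congr_coeff fun l hl => by
      rw [jetSeq_add, jetSeq_smul s y hl]
  have hpz : jetProd k V (x, y, s) ∈ jetDomain k (extDomain K U) := by
    rwa [extDomain_jetDomain] at hp
  have hgz := hg.hasTaylor_comp ho hd (isOpen_extDomain hU) hz hpz
  have h1 := hgz.polynomial_smul c
  have h2 := (hf.hasTaylor_comp ho hd hU hxy hp.2).sub (hf.hasTaylor_comp ho hd hU hx hp.1)
  have hz0 : (γx 0, γy 0, γs 0) ∈ extDomain K U := by
    rw [hz.apply_zero (Nat.succ_pos k)]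
    exact hpz
  have hev : ∀ᶠ t in 𝓝 (0 : K), (γx t, γy t, γs t) ∈ extDomain K U :=
    hz.continuousAt.eventually ((isOpen_extDomain hU).mem_nhds hz0)
  -- One curve now has two expansions: through the jet of `g` and through the jet of `f`. The scalar
  -- `γs t` need not be invertible, so the multiplied form of the quotient identity is essential.
  have h3 := h1.congr (γ' := fun t => f (γx t + γs t • γy t) - f (γx t))
    (hev.mono fun t ht => (hgf _ _ _ ht).symm)
  funext l
  change _ = jetMap K k U f (x + s • y) l - jetMap K k U f x l
  have := h3.unique hd h2 l.2
  rw [← jetSeq_smul s _ l.2] at this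
  simpa only [jetSeq_val] using this

/-- The quotient of the jet map is the jet of the quotient, up to the linear reordering `jetProd`;
as `g` is again smooth, the induction proceeds with `V × V × K` in place of `V`. -/
theorem IsSmooth.isCubicC_jetMap (ho : IsOpen {t : K | IsUnit t}) (hd : Dense {t : K | IsUnit t})
    (k n : ℕ) : ∀ {V : Type (max u v)} [AddCommGroup V] [Module K V] [TopologicalSpace V]
    [IsTopologicalAddGroup V] [ContinuousSMul K V] {U : Set V} (_ : IsOpen U) {f : V → W}
    (_ : IsSmooth.{u, v, w} K U f),
    IsCubicC.{u, v, w} (JetRing K k) n (jetDomain k U) (jetMap K k U f) := by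
  induction n with
  | zero =>
    intro V _ _ _ _ _ U hU f hf
    obtain ⟨G, hG⟩ := hf.exists_extension.{u, v, w} hd hU
    exact hG.continuousOn_jetMap ho hd hU k
  | succ n ih =>
    intro V _ _ _ _ _ U hU f hf
    obtain ⟨G, hG⟩ := hf.exists_extension.{u, v, w} hd hU
    obtain ⟨g, hg, hgf⟩ := hf.exists_quotient.{u, v, w} hd hU
    refine ⟨hG.continuousOn_jetMap ho hd hU k,
      fun p => jetMap K k (extDomain K U) g (jetProd k V p), fun x y t hp => ?_, ?_⟩
    · rw [← smul_jetMap_quotient ho hd hU hf hg hgf hp, smul_smul, Units.inv_mul, one_smul]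
    · rw [extDomain_jetDomain]
      have := (ih (isOpen_extDomain hU) hg).comp_affine (jetProd k V) 0
      simpa only [add_zero] using this

end Quotient

/-! ### Units and powers of `δ` in the jet ring -/

section JetRingUnits

variable {K : Type u} [CommRing K] {k : ℕ}

/-- Truncation of polynomials as a ring homomorphism. -/
def ofPolyHom (K : Type u) [CommRing K] (k : ℕ) : Polynomial K →+* JetRing K k where
  toFun := ofPoly k
  map_one' := ofPoly_one
  map_mul' := ofPoly_mul
  map_zero' := ofPoly_zero
  map_add' := ofPoly_add

/-- An element differs from its constant term by a multiple of `δ`, which is nilpotent. -/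
theorem isUnit_jetRing_iff {a : JetRing K k} : IsUnit a ↔ IsUnit (a 0) := by
  constructor
  · intro h
    obtain ⟨b, hb⟩ := isUnit_iff_exists_inv.1 h
    obtain ⟨p, rfl⟩ := ofPoly_surj a
    obtain ⟨q, rfl⟩ := ofPoly_surj b
    rw [← ofPoly_mul, ← ofPoly_one] at hb
    have h0 : (p * q).coeff 0 = (1 : Polynomial K).coeff 0 := congrFun hb 0
    rw [Polynomial.mul_coeff_zero, Polynomial.coeff_one_zero] at h0
    exact IsUnit.of_mul_eq_one _ h0
  · obtain ⟨p, rfl⟩ := ofPoly_surj a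
    intro (h : IsUnit (p.coeff 0))
    have hn : IsNilpotent (ofPolyHom K k (p.divX * Polynomial.X)) := by
      refine ⟨k + 1, ?_⟩
      rw [← map_pow, mul_pow]
      funext i
      have h0 : (p.divX ^ (k + 1) * Polynomial.X ^ (k + 1)).coeff i = 0 := by
        rw [Polynomial.coeff_mul_X_pow', if_neg (by omega)]
      exact h0
    have hu : IsUnit (ofPolyHom K k (Polynomial.C (p.coeff 0))) :=
      (h.map Polynomial.C).map (ofPolyHom K k)
    have := hn.isUnit_add_left_of_commute hu (Commute.all _ _)
    rwa [← map_add, add_comm, Polynomial.divX_mul_X_add] at this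

theorem ofPoly_monomial_smul {V : Type v} [AddCommGroup V] [Module K V] (i : ℕ) (r : K)
    (y : JetModule k V) (l : Fin (k + 1)) :
    (ofPoly k (Polynomial.monomial i r) • y) l = if i ≤ l then r • jetSeq y (l - i) else 0 := by
  obtain ⟨g, rfl⟩ := ofPolyModule_surj (K := K) y
  rw [← ofPolyModule_smul]
  refine (PolynomialModule.monomial_smul_apply i r g l).trans ?_
  split_ifs with h
  · congr 1
    exact (jetSeq_val (ofPolyModule k g) ⟨l - i, by omega⟩).symm
  · rfl

theorem ofPoly_monomial_pow (i : ℕ) (r : K) (j : ℕ) :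
    (ofPoly k (Polynomial.monomial i r)) ^ j = ofPoly k (Polynomial.monomial (i * j) (r ^ j)) := by
  rw [← Polynomial.monomial_pow]
  exact (map_pow (ofPolyHom K k) (Polynomial.monomial i r) j).symm

theorem ofPoly_const_pow_smul {V : Type v} [AddCommGroup V] [Module K V] (t : K) (l : ℕ)
    (y : JetModule k V) (i : Fin (k + 1)) :
    (ofPoly k (Polynomial.monomial 0 t) ^ l • y) i = t ^ l • y i := by
  rw [ofPoly_monomial_pow, ofPoly_monomial_smul]
  simp [jetSeq_val]

theorem jetModule_sum_apply {V : Type v} [AddCommGroup V] {ι : Type*} (S : Finset ι)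
    (y : ι → JetModule k V) (i : Fin (k + 1)) : (∑ l ∈ S, y l) i = ∑ l ∈ S, y l i :=
  Finset.sum_apply (M := fun _ : Fin (k + 1) => V) i S y

variable [TopologicalSpace K]

/-- The units are the preimage of a dense set under an open projection. -/
theorem dense_isUnit_jetRing (hd : Dense {t : K | IsUnit t}) :
    Dense {a : JetRing K k | IsUnit a} := by
  simp only [isUnit_jetRing_iff]
  exact hd.preimage (isOpenMap_eval (X := fun _ : Fin (k + 1) => K) 0)

theorem continuous_ofPoly_const : Continuous fun t : K => ofPoly k (Polynomial.monomial 0 t) := by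
  refine continuous_pi fun i => ?_
  simp only [ofPoly, Polynomial.coeff_monomial]
  split_ifs <;> fun_prop

end JetRingUnits

/-! ### A smooth map over the jet ring is determined by its base values -/

section Uniqueness

variable {K : Type u} [CommRing K] [TopologicalSpace K] [IsTopologicalRing K]
  {V : Type (max u v)} [AddCommGroup V] [Module K V] [TopologicalSpace V]
  [IsTopologicalAddGroup V] [ContinuousSMul K V]
  {W : Type w} [AddCommGroup W] [Module K W] [TopologicalSpace W]
  [IsTopologicalAddGroup W] [ContinuousSMul K W] [T2Space W] {U : Set V} {k : ℕ}

/-- The values of a smooth map on a jet are the coefficients of a Taylor expansion on the base. -/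
theorem IsSmooth.exists_hasTaylor_jetBase (hd : Dense {t : K | IsUnit t}) (hU : IsOpen U)
    {F : JetModule k V → JetModule k W}
    (hF : IsSmooth.{u, v, w} (JetRing K k) (jetDomain k U) F)
    {z : JetModule k V} (hz : z ∈ jetDomain k U) :
    ∃ C : ℕ → JetModule k W,
      F z = ∑ j ∈ range (k + 1), ofPoly k (Polynomial.monomial j (1 : K)) • C j ∧
      ∀ i, HasTaylor (fun t : K => F (jetBase k (∑ l ∈ range (k + 1), t ^ l • jetSeq z l)) i)
        (k + 1) (fun l => C l i) := by
  have hJ : IsOpen (jetDomain k U) := hU.preimage (continuous_jetModule_apply 0)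
  obtain ⟨G, hG⟩ := hF.exists_extension.{u, v, w} (dense_isUnit_jetRing hd) hJ
  let xs : ℕ → JetModule k V := fun j => jetBase k (jetSeq z j)
  have hxs : xs 0 ∈ jetDomain k U := by
    simpa [xs, jetDomain, jetBase, jetSeq, padZero] using hz
  refine ⟨fun j => G j (xs, 0), ?_, fun i => ?_⟩
  · have e : ∑ j ∈ range (k + 1), (ofPoly k (Polynomial.monomial 1 (1 : K))) ^ j • xs j +
        (ofPoly k (Polynomial.monomial 1 (1 : K))) ^ (k + 1) • (0 : JetModule k V) = z := by
      rw [smul_zero, add_zero]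
      funext l
      rw [jetModule_sum_apply, sum_eq_single (l : ℕ)]
      · rw [ofPoly_monomial_pow, ofPoly_monomial_smul]
        simp only [one_mul, le_refl, if_true, one_pow, one_smul, Nat.sub_self]
        refine (jetSeq_val (xs l) 0).trans ?_
        simp [xs, jetBase, jetSeq_val]
      · intro j _ hj
        rw [ofPoly_monomial_pow, ofPoly_monomial_smul]
        split_ifs with h
        · have h1 : (l : ℕ) - 1 * j < k + 1 := by omega
          have h2 : (⟨(l : ℕ) - 1 * j, h1⟩ : Fin (k + 1)) ≠ 0 := by
            rw [Ne, Fin.ext_iff]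
            simp only [Fin.val_zero]
            omega
          have h3 := jetSeq_val (xs j) ⟨(l : ℕ) - 1 * j, h1⟩
          simp only at h3
          rw [h3, one_pow, one_smul]
          exact if_neg h2
        · rfl
      · intro h
        exact absurd (mem_range.2 l.2) h
    have h := hG.taylor hxs (ofPoly k (Polynomial.monomial 1 (1 : K))) (k + 1) 0
      (by rw [e]; exact hz)
    rw [e] at h
    have h0 : ofPoly k (Polynomial.monomial (k + 1) (1 : K)) = 0 := by
      funext i
      exact Polynomial.coeff_monomial_of_ne _ (by omega)
    simpa only [ofPoly_monomial_pow, one_mul, one_pow, h0, zero_smul, add_zero] using h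
  -- The same coefficients also govern the expansion at scalars `c t` coming from `K`. These act
  -- componentwise, so the curve stays in the base and each component of `F` has an expansion over
  -- `K`.
  · obtain ⟨r, hr, h⟩ := hG.hasTaylor_comp hJ (hasTaylor_sum_pow_smul (k + 1) xs)
      (Nat.succ_pos k) hxs
    let c : K → JetRing K k := fun t => ofPoly k (Polynomial.monomial 0 t)
    have hc : Continuous c := continuous_ofPoly_const
    have hc0 : c 0 = 0 := by simp only [c, Polynomial.monomial_zero_right]; exact ofPoly_zero
    have hc' : Tendsto c (𝓝 0) (𝓝 0) := hc0 ▸ hc.tendsto 0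
    refine ⟨fun t => r (c t) i, ?_, ?_⟩
    · refine (continuous_jetModule_apply i).continuousAt.comp
        (ContinuousAt.comp (f := c) ?_ hc.continuousAt)
      rwa [hc0]
    · filter_upwards [hc'.eventually h] with t ht
      have e : ∑ l ∈ range (k + 1), c t ^ l • xs l =
          jetBase k (∑ l ∈ range (k + 1), t ^ l • jetSeq z l) := by
        funext m
        rw [jetModule_sum_apply]
        simp only [c, ofPoly_const_pow_smul]
        by_cases hm : m = 0 <;> simp [xs, jetBase, hm]
      rw [e] at ht
      rw [ht]
      change (∑ l ∈ range (k + 1), c t ^ l • G l (xs, 0)) i + (c t ^ (k + 1) • r (c t)) i = _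
      rw [jetModule_sum_apply]
      simp only [c, ofPoly_const_pow_smul]

theorem IsSmooth.eqOn_jetDomain (hd : Dense {t : K | IsUnit t}) (hU : IsOpen U)
    {F F' : JetModule k V → JetModule k W}
    (hF : IsSmooth.{u, v, w} (JetRing K k) (jetDomain k U) F)
    (hF' : IsSmooth.{u, v, w} (JetRing K k) (jetDomain k U) F')
    (h : ∀ x ∈ U, F (jetBase k x) = F' (jetBase k x)) : Set.EqOn F F' (jetDomain k U) := by
  intro z hz
  obtain ⟨C, hC, hCt⟩ := hF.exists_hasTaylor_jetBase hd hU hz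
  obtain ⟨C', hC', hCt'⟩ := hF'.exists_hasTaylor_jetBase hd hU hz
  rw [hC, hC']
  refine sum_congr rfl fun l hl => ?_
  congr 1
  funext i
  -- Near `t = 0` the curve lies in `U`, so `F` and `F'` agree along its image in the base and their
  -- Taylor coefficients coincide.
  refine ((hCt i).congr ?_).unique hd (hCt' i) (mem_range.1 hl)
  have hγ := hasTaylor_sum_pow_smul (K := K) (k + 1) (jetSeq z)
  have h0 : ∑ l ∈ range (k + 1), (0 : K) ^ l • jetSeq z l ∈ U := by
    rw [hγ.apply_zero (Nat.succ_pos k)]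
    exact hz
  have hev := hγ.continuousAt.eventually (hU.mem_nhds h0)
  filter_upwards [hev] with t ht
  rw [h _ ht]

end Uniqueness

end JetCalc

/-! ### The simplicial scalar extension theorem -/

theorem theorem2 {K : Type u} [CommRing K] [TopologicalSpace K] [IsTopologicalRing K]
    (hKopen : IsOpen {t : K | IsUnit t}) (hKdense : Dense {t : K | IsUnit t})
    (hKinv : ContinuousOn (Ring.inverse : K → K) {t : K | IsUnit t})
    {V : Type (max u v)} [AddCommGroup V] [Module K V] [TopologicalSpace V]
    [IsTopologicalAddGroup V] [ContinuousSMul K V]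
    {W : Type w} [AddCommGroup W] [Module K W] [TopologicalSpace W]
    [IsTopologicalAddGroup W] [ContinuousSMul K W] [T2Space W]
    (U : Set V) (hU : IsOpen U) (k : ℕ) :
    (∀ f : V → W, JetCalc.IsSmooth.{u, v, w} K U f →
      JetCalc.IsSimplicialC K k U f ∧
      JetCalc.IsSmooth.{u, v, w} (JetCalc.JetRing K k)
        (JetCalc.jetDomain k U) (JetCalc.jetMap K k U f) ∧
      (∀ x ∈ U, JetCalc.jetMap K k U f (JetCalc.jetBase k x) = JetCalc.jetBase k (f x)) ∧
      (∀ F : JetCalc.JetModule k V → JetCalc.JetModule k W,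
        JetCalc.IsSmooth.{u, v, w} (JetCalc.JetRing K k) (JetCalc.jetDomain k U) F →
        (∀ x ∈ U, F (JetCalc.jetBase k x) = JetCalc.jetBase k (f x)) →
        Set.EqOn F (JetCalc.jetMap K k U f) (JetCalc.jetDomain k U))) ∧
    (∀ F G : JetCalc.JetModule k V → JetCalc.JetModule k W,
      JetCalc.IsSmooth.{u, v, w} (JetCalc.JetRing K k) (JetCalc.jetDomain k U) F →
      JetCalc.IsSmooth.{u, v, w} (JetCalc.JetRing K k) (JetCalc.jetDomain k U) G →
      (∀ x ∈ U, F (JetCalc.jetBase k x) = G (JetCalc.jetBase k x)) →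
      Set.EqOn F G (JetCalc.jetDomain k U)) := by
  have unique := fun (F F' : JetCalc.JetModule k V → JetCalc.JetModule k W)
      (hF : JetCalc.IsSmooth.{u, v, w} (JetCalc.JetRing K k) (JetCalc.jetDomain k U) F) hF' =>
    hF.eqOn_jetDomain (F' := F') hKdense hU hF'
  refine ⟨fun f hf => ?_, unique⟩
  have hJ : JetCalc.IsSmooth.{u, v, w} (JetCalc.JetRing K k) (JetCalc.jetDomain k U)
      (JetCalc.jetMap K k U f) := fun n => hf.isCubicC_jetMap hKopen hKdense k n hU
  have hbase := fun x (hx : x ∈ U) => JetCalc.jetMap_jetBase hf hKopen hKdense hU k hx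
  obtain ⟨G, hG⟩ := hf.exists_extension.{u, v, w} hKdense hU
  refine ⟨hG.isSimplicialC k, hJ, hbase, fun F hF h => unique F _ hF hJ fun x hx => ?_⟩
  rw [h x hx, hbase x hx]
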